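/- Let $\mathbb L^4$ be $\mathbb R^4$ with the Lorentz metric $\langle x,y\rangle=-x_0y_0+x_1y_1+x_2y_2+x_3y_3$, let $\mathbb H^3=\{x\in\mathbb L^4: \langle x,x\rangle=-1,\ x_0>0\}$ be hyperbolic $3$-space, and let $U\mathbb H^3=\{(p,v): p\in\mathbb H^3,\ \langle v,v\rangle=1,\ \langle p,v\rangle=0\}$ be its unit tangent bundle, with tangent spaces $T_{(p,v)}U\mathbb H^3=\{(X,V): \langle p,X\rangle=\langle v,V\rangle=0,\ \langle p,V\rangle=-\langle X,v\rangle\}$ and canonical contact form $\Theta_{(p,v)}(X,V)=\langle X,v\rangle$. Let $L\mathbb H^3$ be the space of oriented geodesics, i.e. of unit speed geodesics of $\mathbb H^3$ modulo translations of the parameter, and let $\hat\pi:U\mathbb H^3\to L\mathbb H^3$ send $(p,v)$ to the class of the geodesic starting at $p$ with initial velocity $v$. Identify the ideal boundary of $\mathbb H^3$ with $\hat{\mathbb C}=\mathbb C\cup\{\infty\}$ by means of the isometry $x\mapsto\left(\frac{x_1+ix_2}{x_0-x_3},\frac1{x_0-x_3}\right)$ onto the upper half-space model $\{(w,r)\in\mathbb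 C\times\mathbb R: r>0\}$, and write $\gamma_\pm=\lim_{t\to\pm\infty}\gamma(t)\in\hat{\mathbb C}$ for the endpoints of $[\gamma]\in L\mathbb H^3$. The functions $\mu_1=-\gamma_-$, $\mu_2=1/\bar\gamma_+$ are coordinates on $\{\gamma_+\ne0,\ \gamma_-\ne\infty\}$, the functions $(1/\mu_1,1/\mu_2)$ are coordinates on $\{\gamma_+\ne\infty,\ \gamma_-\neq 0\}$, and these two coordinate systems make $L\mathbb H^3$ a smooth real $4$-manifold. The following tensors, given by the same expressions in both coordinate systems, are well defined on all of $L\mathbb H^3$: $$\mathcal G=\frac{4\,d\mu_1\,d\bar\mu_2}{(1+\mu_1\bar\mu_2)^2},\qquad \mathcal G^{\mathfrak r}=\operatorname{Re}\mathcal G,\qquad \mathcal G^{\mathfrak i}=\operatorname{Im}\mathcal G$$ ($d\mu_1\,d\bar\mu_2$ is the symmetric product, $(d\mu_1\,d\bar\mu_2)(X,X)=d\mu_1(X)\,d\bar\mu_2(X)$), $$J\tfrac{\partial}{\partial\mu_1}=i\tfrac{\partial}{\partial\mu_1},\quad J\tfrac{\partial}{\partial\mu_2}=i\tfrac{\partial}{\partial\mu_2},\qquad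 P\tfrac{\partial}{\partial\mu_1}=-\tfrac{\partial}{\partial\mu_1},\quad P\tfrac{\partial}{\partial\mu_2}=\tfrac{\partial}{\partial\mu_2}.$$ Let $\omega_J=\mathcal G^{\mathfrak i}(\cdot,J\cdot)$ be the Kähler form of $(\mathcal G^{\mathfrak i},J)$ and $\omega_P=\mathcal G^{\mathfrak r}(\cdot,P\cdot)$ the para-Kähler form of $(\mathcal G^{\mathfrak r},P)$. The exterior derivative of a $1$-form is normalized by $d\Theta(X,Y)=\frac12\bigl(X(\Theta(Y))-Y(\Theta(X))-\Theta([X,Y])\bigr)$. Proposition. There is exactly one symplectic form (smooth closed nondegenerate $2$-form) $\omega$ on $L\mathbb H^3$ with $\hat\pi^*\omega=d\Theta$, the canonical symplectic form, and it satisfies $$\omega_J=-\omega_P=-2\,\omega .$$ -/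

import Mathlib

open scoped ContDiff Manifold Topology ComplexConjugate

noncomputable section

namespace HypGeod

/-- Lorentz-Minkowski `4`-space. -/
abbrev L4 : Type := Fin 4 → ℝ

/-- The Lorentz metric. -/
def lor (x y : L4) : ℝ := -(x 0 * y 0) + x 1 * y 1 + x 2 * y 2 + x 3 * y 3

/-- Hyperbolic `3`-space (hyperboloid model). -/
def H3 : Set L4 := {x | lor x x = -1 ∧ 0 < x 0}

/-- The unit tangent bundle of hyperbolic `3`-space. -/
def UH3 : Set (L4 × L4) := {u | u.1 ∈ H3 ∧ lor u.2 u.2 = 1 ∧ lor u.1 u.2 = 0}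

/-- Unit speed geodesics of `H3`: smooth curves with values in `H3`, of unit speed, whose
acceleration has vanishing component tangent to `H3` (the tangential part of a vector `A` at
`x ∈ H3` is `A + ⟨A, x⟩ x`). -/
structure Geodesic where
  toFun : ℝ → L4
  smooth : ContDiff ℝ ∞ toFun
  mem_H3 : ∀ t, toFun t ∈ H3
  unit_speed : ∀ t, lor (deriv toFun t) (deriv toFun t) = 1
  geodesic : ∀ t, deriv (deriv toFun) t
    + lor (deriv (deriv toFun) t) (toFun t) • toFun t = 0

/-- Two unit speed geodesics are equivalent if they differ by a translation of the parameter. -/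
instance geodesicSetoid : Setoid Geodesic where
  r γ₁ γ₂ := ∃ t₀ : ℝ, ∀ t, γ₁.toFun (t + t₀) = γ₂.toFun t
  iseqv :=
    { refl := fun γ => ⟨0, fun t => by simp⟩
      symm := by
        rintro γ₁ γ₂ ⟨t₀, h⟩
        exact ⟨-t₀, fun t => by rw [← h (t + -t₀)]; simp⟩
      trans := by
        rintro γ₁ γ₂ γ₃ ⟨t₀, h⟩ ⟨s₀, k⟩
        exact ⟨s₀ + t₀, fun t => by rw [← k t, ← h (t + s₀), add_assoc]⟩ }

/-- The space of oriented geodesics of `H3`. -/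
def LH3 : Type := Quotient geodesicSetoid

lemma lor_comm (x y : L4) : lor x y = lor y x := by simp only [lor]; ring

/-- The curve `t ↦ cosh t • p + sinh t • v`. -/
def hypLine (u : L4 × L4) (t : ℝ) : L4 := Real.cosh t • u.1 + Real.sinh t • u.2

lemma hasDerivAt_hypLine (u : L4 × L4) (t : ℝ) :
    HasDerivAt (hypLine u) (hypLine (u.2, u.1) t) t := by
  have h := ((Real.hasDerivAt_cosh t).smul_const u.1).add
    ((Real.hasDerivAt_sinh t).smul_const u.2)
  have e : hypLine (u.2, u.1) t = Real.sinh t • u.1 + Real.cosh t • u.2 := by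
    simp only [hypLine]; exact add_comm _ _
  rw [e]; exact h

lemma deriv_hypLine (u : L4 × L4) : deriv (hypLine u) = hypLine (u.2, u.1) :=
  funext fun t => (hasDerivAt_hypLine u t).deriv

lemma fut {p v : L4} (h : (p, v) ∈ UH3) : |v 0| < p 0 := by
  obtain ⟨⟨h1, h2⟩, h3, h4⟩ := h
  simp only [lor] at *
  have : v 0 ^ 2 < p 0 ^ 2 := by
    have e : p 0 * v 0 = p 1 * v 1 + p 2 * v 2 + p 3 * v 3 := by linarith
    have e2 : (p 0 * v 0) ^ 2 ≤ (p 1 ^ 2 + p 2 ^ 2 + p 3 ^ 2) * (v 1 ^ 2 + v 2 ^ 2 + v 3 ^ 2) := by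
      rw [e]
      nlinarith [sq_nonneg (p 1 * v 2 - p 2 * v 1), sq_nonneg (p 1 * v 3 - p 3 * v 1),
        sq_nonneg (p 2 * v 3 - p 3 * v 2)]
    have e3 : p 1 ^ 2 + p 2 ^ 2 + p 3 ^ 2 = p 0 ^ 2 - 1 := by linarith
    have e4 : v 1 ^ 2 + v 2 ^ 2 + v 3 ^ 2 = v 0 ^ 2 + 1 := by linarith
    rw [e3, e4] at e2
    nlinarith
  exact abs_lt_of_sq_lt_sq this h2.le

lemma hypLine_mem {u : L4 × L4} (h : u ∈ UH3) (t : ℝ) : hypLine u t ∈ H3 := by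
  have hf := fut (p := u.1) (v := u.2) h
  obtain ⟨⟨h1, h2⟩, h3, h4⟩ := h
  have hc := Real.cosh_sq t
  refine ⟨?_, ?_⟩
  · simp only [lor, hypLine, Pi.add_apply, Pi.smul_apply, smul_eq_mul] at *
    linear_combination Real.cosh t ^ 2 * h1 + Real.sinh t ^ 2 * h3
      + 2 * Real.cosh t * Real.sinh t * h4 - hc
  · simp only [hypLine, Pi.add_apply, Pi.smul_apply, smul_eq_mul]
    have h5 : |Real.sinh t| < Real.cosh t :=
      abs_lt_of_sq_lt_sq (by nlinarith) (Real.cosh_pos t).le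
    have h6 : |Real.sinh t * u.2 0| < Real.cosh t * u.1 0 := by
      rw [abs_mul]
      exact mul_lt_mul'' h5 hf (abs_nonneg _) (abs_nonneg _)
    linarith [neg_abs_le (Real.sinh t * u.2 0)]

/-- The geodesic starting at `p` with initial velocity `v`, for `(p, v) ∈ UH3`. -/
def geodesicOf (u : UH3) : Geodesic where
  toFun := hypLine u.1
  smooth := by
    unfold hypLine
    exact (Real.contDiff_cosh.smul contDiff_const).add (Real.contDiff_sinh.smul contDiff_const)
  mem_H3 := hypLine_mem u.2
  unit_speed := fun t => by
    obtain ⟨u, ⟨h1, h2⟩, h3, h4⟩ := u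
    have hc := Real.cosh_sq t
    rw [deriv_hypLine]
    simp only [lor] at h1 h3 h4
    simp only [lor, hypLine, Pi.add_apply, Pi.smul_apply, smul_eq_mul]
    linear_combination Real.cosh t ^ 2 * h3 + Real.sinh t ^ 2 * h1
      + 2 * Real.cosh t * Real.sinh t * h4 + hc
  geodesic := fun t => by
    rw [deriv_hypLine, deriv_hypLine]
    change hypLine u.1 t + lor (hypLine u.1 t) (hypLine u.1 t) • hypLine u.1 t = 0
    rw [(hypLine_mem u.2 t).1]; simp

/-- The projection `UH3 → LH3`, sending `(p, v)` to the class of the geodesic starting at `p` with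
initial velocity `v`. -/
def piHat (u : UH3) : LH3 := Quotient.mk geodesicSetoid (geodesicOf u)

lemma geodesicOf_start (u : UH3) : (geodesicOf u).toFun 0 = u.1.1 := by
  simp [geodesicOf, hypLine]

lemma geodesicOf_velocity (u : UH3) : deriv (geodesicOf u).toFun 0 = u.1.2 := by
  change deriv (hypLine u.1) 0 = u.1.2
  rw [deriv_hypLine]; simp [hypLine]

lemma hasDerivAt_lor {f g : ℝ → L4} {f' g' : L4} {t : ℝ} (hf : HasDerivAt f f' t)
    (hg : HasDerivAt g g' t) :
    HasDerivAt (fun s => lor (f s) (g s)) (lor f' (g t) + lor (f t) g') t := by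
  have hf := hasDerivAt_pi.1 hf
  have hg := hasDerivAt_pi.1 hg
  have := ((((hf 0).mul (hg 0)).neg.add ((hf 1).mul (hg 1))).add ((hf 2).mul (hg 2))).add
    ((hf 3).mul (hg 3))
  refine this.congr_deriv ?_
  simp only [lor]; ring

lemma Geodesic.hasDerivAt (γ : Geodesic) (t : ℝ) :
    HasDerivAt γ.toFun (deriv γ.toFun t) t :=
  ((γ.smooth.differentiable (by simp)) t).hasDerivAt

lemma Geodesic.hasDerivAt_deriv (γ : Geodesic) (t : ℝ) :
    HasDerivAt (deriv γ.toFun) (deriv (deriv γ.toFun) t) t := by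
  have : ContDiff ℝ 1 (deriv γ.toFun) := by
    have h := γ.smooth.of_le (m := 2) (WithTop.coe_le_coe.2 le_top : ((2 : ℕ∞) : ℕ∞ω) ≤ ∞)
    exact ((contDiff_succ_iff_deriv (n := 1)).1 h).2.2
  exact ((this.differentiable (by simp)) t).hasDerivAt

lemma Geodesic.lor_vel (γ : Geodesic) (t : ℝ) : lor (γ.toFun t) (deriv γ.toFun t) = 0 := by
  have h := hasDerivAt_lor (γ.hasDerivAt t) (γ.hasDerivAt t)
  have h2 : (fun s => lor (γ.toFun s) (γ.toFun s)) = fun _ => -1 :=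
    funext fun s => (γ.mem_H3 s).1
  rw [h2] at h
  have := h.unique (hasDerivAt_const t (-1 : ℝ))
  rw [lor_comm (deriv _ _)] at this
  linarith

lemma Geodesic.deriv2 (γ : Geodesic) (t : ℝ) : deriv (deriv γ.toFun) t = γ.toFun t := by
  have h := hasDerivAt_lor (γ.hasDerivAt t) (γ.hasDerivAt_deriv t)
  have h2 : (fun s => lor (γ.toFun s) (deriv γ.toFun s)) = fun _ => 0 :=
    funext fun s => γ.lor_vel s
  rw [h2] at h
  have h3 := h.unique (hasDerivAt_const t (0 : ℝ))
  rw [γ.unit_speed, lor_comm] at h3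
  have h4 : lor (deriv (deriv γ.toFun) t) (γ.toFun t) = -1 := by linarith
  have h5 := γ.geodesic t
  rw [h4] at h5
  rw [neg_one_smul] at h5
  exact add_neg_eq_zero.1 h5

/-- The initial position and velocity of a geodesic. -/
def Geodesic.init (γ : Geodesic) : UH3 :=
  ⟨(γ.toFun 0, deriv γ.toFun 0), γ.mem_H3 0, γ.unit_speed 0, γ.lor_vel 0⟩

lemma Geodesic.eq_hypLine (γ : Geodesic) : γ.toFun = hypLine γ.init.1 := by
  have key : ∀ ε : ℝ, ε ^ 2 = 1 → ∀ t, γ.toFun t + ε • deriv γ.toFun t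
      = Real.exp (ε * t) • (γ.toFun 0 + ε • deriv γ.toFun 0) := by
    intro ε hε t
    have hd : ∀ s, HasDerivAt (fun s => Real.exp (-(ε * s)) • (γ.toFun s + ε • deriv γ.toFun s))
        0 s := by
      intro s
      have h1 := (γ.hasDerivAt s).add ((γ.hasDerivAt_deriv s).const_smul ε)
      have h2 : HasDerivAt (fun s => Real.exp (-(ε * s))) (Real.exp (-(ε * s)) * (-ε)) s := by
        have := ((hasDerivAt_id s).const_mul ε).neg.exp
        simpa using this
      refine (h2.smul h1).congr_deriv ?_
      rw [γ.deriv2]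
      ext i
      simp only [Pi.add_apply, Pi.smul_apply, smul_eq_mul, Pi.zero_apply]
      linear_combination -(Real.exp (-(ε * s)) * deriv γ.toFun s i) * hε
    have hc := is_const_of_deriv_eq_zero (fun s => (hd s).differentiableAt)
      (fun s => (hd s).deriv) t 0
    simp only [mul_zero, neg_zero, Real.exp_zero, one_smul] at hc
    rw [← hc, smul_smul, ← Real.exp_add]; simp
  funext t
  have h1 := key 1 (by norm_num) t
  have h2 := key (-1) (by norm_num) t
  ext i
  have h1 := congrFun h1 i
  have h2 := congrFun h2 i
  simp only [Pi.add_apply, Pi.smul_apply, smul_eq_mul, one_mul, neg_one_mul, hypLine,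
    Geodesic.init, Real.cosh_eq, Real.sinh_eq] at *
  linear_combination (h1 + h2) / 2

lemma piHat_init (γ : Geodesic) : piHat γ.init = Quotient.mk geodesicSetoid γ := by
  apply Quotient.sound
  exact ⟨0, fun t => by rw [γ.eq_hypLine]; simp [geodesicOf]⟩

lemma piHat_surjective : Function.Surjective piHat := by
  intro x
  induction x using Quotient.inductionOn with
  | _ γ => exact ⟨γ.init, piHat_init γ⟩

/-- The isometry from the hyperboloid model onto the upper half-space model
`{(w, r) ∈ ℂ × ℝ | 0 < r}`. -/
def halfSpace (x : L4) : ℂ × ℝ :=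
  (((x 1 : ℂ) + Complex.I * (x 2 : ℂ)) / ((x 0 : ℂ) - (x 3 : ℂ)), 1 / (x 0 - x 3))

open Classical in
/-- The limit along `l` of a curve in hyperbolic space, as a point of the ideal boundary
`ℂ ∪ {∞}` of the upper half-space: a finite point `z` if the curve converges to `(z, 0)`, and `∞`
otherwise. Only used for geodesics, with `l = atTop` or `l = atBot`. -/
def idealLimit (l : Filter ℝ) (c : ℝ → L4) : OnePoint ℂ :=
  if h : ∃ z : ℂ, Filter.Tendsto (fun t => halfSpace (c t)) l (𝓝 (z, 0)) then
    ((h.choose : ℂ) : OnePoint ℂ) else OnePoint.infty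

open Classical in
/-- The point of `ℂ ∪ {∞}` given by a null vector. -/
def nullPt (n : L4) : OnePoint ℂ :=
  if n 0 - n 3 = 0 then OnePoint.infty else
    (((((n 1 : ℂ) + Complex.I * (n 2 : ℂ)) / ((n 0 : ℂ) - (n 3 : ℂ)) : ℂ)) : OnePoint ℂ)

lemma hypLine_coord (u : L4 × L4) (t : ℝ) (i : Fin 4) :
    hypLine u t i = (Real.exp t * ((u.1 i + u.2 i) + Real.exp (-2 * t) * (u.1 i - u.2 i))) / 2 := by
  have : Real.exp t * Real.exp (-2 * t) = Real.exp (-t) := by rw [← Real.exp_add]; ring_nf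
  simp only [hypLine, Pi.add_apply, Pi.smul_apply, smul_eq_mul, Real.cosh_eq, Real.sinh_eq]
  linear_combination (u.2 i - u.1 i) / 2 * this

lemma idealLimit_congr {l l' : Filter ℝ} {c c' : ℝ → L4}
    (e : ∀ z : ℂ, Filter.Tendsto (fun t => halfSpace (c t)) l (𝓝 (z, 0)) ↔
      Filter.Tendsto (fun t => halfSpace (c' t)) l' (𝓝 (z, 0))) :
    idealLimit l c = idealLimit l' c' := by
  have e' := funext fun z => propext (e z)
  unfold idealLimit
  generalize (fun z : ℂ => Filter.Tendsto (fun t => halfSpace (c t)) l (𝓝 (z, 0))) = P at e'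
  subst e'
  rfl

lemma idealLimit_eq_of_tendsto {l : Filter ℝ} [l.NeBot] {c : ℝ → L4} {z : ℂ}
    (h : Filter.Tendsto (fun t => halfSpace (c t)) l (𝓝 (z, 0))) : idealLimit l c = z := by
  have h' : ∃ z : ℂ, Filter.Tendsto (fun t => halfSpace (c t)) l (𝓝 (z, 0)) := ⟨z, h⟩
  rw [idealLimit, dif_pos h']
  have := tendsto_nhds_unique h'.choose_spec h
  exact congrArg _ (Prod.ext_iff.1 this).1

lemma pos_sub {u : L4 × L4} (h : u ∈ UH3) : 0 < u.1 0 - u.1 3 := by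
  obtain ⟨⟨h1, h2⟩, -⟩ := h
  simp only [lor] at h1
  nlinarith [sq_nonneg (u.1 1), sq_nonneg (u.1 2)]

lemma idealLimit_atTop {u : L4 × L4} (hu : u ∈ UH3) :
    idealLimit Filter.atTop (hypLine u) = nullPt (u.1 + u.2) := by
  have e2 : Filter.Tendsto (fun t : ℝ => Real.exp (-2 * t)) Filter.atTop (𝓝 0) :=
    Real.tendsto_exp_atBot.comp
      (Filter.tendsto_id.const_mul_atTop_of_neg (by norm_num : (-2 : ℝ) < 0))
  have e1 : Filter.Tendsto (fun t : ℝ => Real.exp (-t)) Filter.atTop (𝓝 0) :=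
    Real.tendsto_exp_neg_atTop_nhds_zero
  have lim : ∀ i, Filter.Tendsto (fun t : ℝ => (u.1 i + u.2 i) + Real.exp (-2 * t) *
      (u.1 i - u.2 i)) Filter.atTop (𝓝 (u.1 i + u.2 i)) := by
    intro i
    simpa only [zero_mul, add_zero] using
      (e2.mul_const (u.1 i - u.2 i)).const_add (u.1 i + u.2 i)
  by_cases h : (u.1 + u.2) 0 - (u.1 + u.2) 3 = 0
  · rw [nullPt, if_pos h, idealLimit, dif_neg]
    rintro ⟨z, hz⟩
    have h2 := (Prod.tendsto_iff _ _).1 hz |>.2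
    simp only [halfSpace] at h2
    simp only [Pi.add_apply] at h
    have hp := pos_sub hu
    have h3 : (fun t => 1 / (hypLine u t 0 - hypLine u t 3)) =
        fun t => Real.exp t * (1 / (u.1 0 - u.1 3)) := by
      funext t
      have h4 : hypLine u t 0 - hypLine u t 3 = Real.exp (-t) * (u.1 0 - u.1 3) := by
        have : Real.exp t * Real.exp (-2 * t) = Real.exp (-t) := by rw [← Real.exp_add]; ring_nf
        rw [hypLine_coord, hypLine_coord]
        linear_combination (Real.exp t / 2 - Real.exp (-t) / 2) * h
          + (u.1 0 - u.2 0 - u.1 3 + u.2 3) / 2 * this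
      rw [h4, Real.exp_neg]
      field_simp
    rw [h3] at h2
    exact not_tendsto_nhds_of_tendsto_atTop
      (Real.tendsto_exp_atTop.atTop_mul_const (by positivity)) _ h2
  · rw [nullPt, if_neg h]
    apply idealLimit_eq_of_tendsto
    simp only [Pi.add_apply] at h
    have hden := (lim 0).sub (lim 3)
    have hC : ∀ {f : ℝ → ℝ} {a : ℝ}, Filter.Tendsto f Filter.atTop (𝓝 a) →
        Filter.Tendsto (fun t => (f t : ℂ)) Filter.atTop (𝓝 (a : ℂ)) := fun hf =>
      (Complex.continuous_ofReal.tendsto _).comp hf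
    refine Filter.Tendsto.prodMk_nhds ?_ ?_
    · have := ((hC (lim 1)).add ((hC (lim 2)).const_mul Complex.I)).div
        ((hC (lim 0)).sub (hC (lim 3)))
        (by rw [← Complex.ofReal_sub]; exact_mod_cast h)
      simp only [Pi.add_apply]
      refine this.congr fun t => ?_
      simp only [hypLine_coord, Pi.div_apply]
      push_cast
      have he : Complex.exp (t : ℂ) ≠ 0 := Complex.exp_ne_zero _
      rw [show ∀ E a b c d : ℂ, (E * a / 2 + Complex.I * (E * b / 2)) / (E * c / 2 - E * d / 2) =
        (E / 2 * (a + Complex.I * b)) / (E / 2 * (c - d)) from fun E a b c d => by ring_nf]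
      rw [mul_div_mul_left _ _ (by simpa using he)]
    · have := (e1.const_mul 2).div hden h
      rw [mul_zero, zero_div] at this
      refine this.congr fun t => ?_
      simp only [hypLine_coord, Pi.div_apply]
      rw [Real.exp_neg]
      have he := Real.exp_ne_zero t
      rw [show ∀ E c d : ℝ, E * c / 2 - E * d / 2 = (E / 2) * (c - d) from fun E c d => by ring]
      rw [one_div, mul_inv, div_eq_mul_inv]
      congr 1
      field_simp

lemma neg_mem_UH3 {u : L4 × L4} (h : u ∈ UH3) : (u.1, -u.2) ∈ UH3 := by
  obtain ⟨h1, h3, h4⟩ := h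
  refine ⟨h1, ?_, ?_⟩
  · simp only [lor, Pi.neg_apply] at *; linarith
  · simp only [lor, Pi.neg_apply] at *; linarith

lemma idealLimit_atBot {u : L4 × L4} (hu : u ∈ UH3) :
    idealLimit Filter.atBot (hypLine u) = nullPt (u.1 - u.2) := by
  have h := idealLimit_atTop (neg_mem_UH3 hu)
  simp only [← sub_eq_add_neg] at h
  rw [← h]
  have e : ∀ z : ℂ, Filter.Tendsto (fun t => halfSpace (hypLine u t)) Filter.atBot (𝓝 (z, 0)) ↔
      Filter.Tendsto (fun t => halfSpace (hypLine (u.1, -u.2) t)) Filter.atTop (𝓝 (z, 0)) := by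
    intro z
    have e2 : (fun t => halfSpace (hypLine (u.1, -u.2) t)) =
        (fun t => halfSpace (hypLine u t)) ∘ Neg.neg := by
      funext t
      simp [hypLine]
    rw [e2, ← Filter.tendsto_map'_iff, Filter.map_neg_atTop]
  exact idealLimit_congr e

lemma nullPt_smul {c : ℝ} (hc : 0 < c) (n : L4) : nullPt (c • n) = nullPt n := by
  simp only [nullPt, Pi.smul_apply, smul_eq_mul, ← mul_sub, mul_eq_zero, hc.ne', false_or]
  split_ifs with h
  · rfl
  · push_cast
    rw [show ∀ E a b c d : ℂ, (E * a + Complex.I * (E * b)) / (E * c - E * d) =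
        (E * (a + Complex.I * b)) / (E * (c - d)) from fun E a b c d => by ring_nf]
    rw [mul_div_mul_left _ _ (by exact_mod_cast hc.ne')]

lemma idealLimit_shift (l : Filter ℝ) (t₀ : ℝ) (hl : Filter.map (· + t₀) l = l) (c : ℝ → L4) :
    idealLimit l (fun t => c (t + t₀)) = idealLimit l c := by
  have e : ∀ z : ℂ, Filter.Tendsto (fun t => halfSpace (c (t + t₀))) l (𝓝 (z, 0)) ↔
      Filter.Tendsto (fun t => halfSpace (c t)) l (𝓝 (z, 0)) := by
    intro z
    conv_rhs => rw [← hl, Filter.tendsto_map'_iff]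
    rfl
  exact idealLimit_congr e

/-- The endpoint `γ₊ = lim_{t → ∞} γ(t)` of an oriented geodesic. -/
def endPlus (x : LH3) : OnePoint ℂ :=
  Quotient.lift (fun γ : Geodesic => idealLimit Filter.atTop γ.toFun) (by
    rintro γ₁ γ₂ ⟨t₀, h⟩
    have : γ₂.toFun = fun t => γ₁.toFun (t + t₀) := funext fun t => (h t).symm
    simp only [this]
    rw [idealLimit_shift _ _ (Filter.map_add_atTop_eq t₀)]) x

/-- The endpoint `γ₋ = lim_{t → -∞} γ(t)` of an oriented geodesic. -/
def endMinus (x : LH3) : OnePoint ℂ :=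
  Quotient.lift (fun γ : Geodesic => idealLimit Filter.atBot γ.toFun) (by
    rintro γ₁ γ₂ ⟨t₀, h⟩
    have : γ₂.toFun = fun t => γ₁.toFun (t + t₀) := funext fun t => (h t).symm
    simp only [this]
    exact (idealLimit_shift _ t₀ ((OrderIso.addRight t₀).map_atBot) _).symm) x

lemma endPlus_piHat (u : UH3) : endPlus (piHat u) = nullPt (u.1.1 + u.1.2) :=
  idealLimit_atTop u.2

lemma endMinus_piHat (u : UH3) : endMinus (piHat u) = nullPt (u.1.1 - u.1.2) :=
  idealLimit_atBot u.2

lemma null_add {u : L4 × L4} (h : u ∈ UH3) : lor (u.1 + u.2) (u.1 + u.2) = 0 := by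
  obtain ⟨⟨h1, -⟩, h3, h4⟩ := h
  simp only [lor] at h1 h3 h4
  simp only [lor, Pi.add_apply]
  linear_combination h1 + h3 + 2 * h4

lemma null_sub {u : L4 × L4} (h : u ∈ UH3) : lor (u.1 - u.2) (u.1 - u.2) = 0 := by
  obtain ⟨⟨h1, -⟩, h3, h4⟩ := h
  simp only [lor] at h1 h3 h4
  simp only [lor, Pi.sub_apply]
  linear_combination h1 + h3 - 2 * h4

lemma lor_add_sub {u : L4 × L4} (h : u ∈ UH3) : lor (u.1 + u.2) (u.1 - u.2) = -2 := by
  obtain ⟨⟨h1, -⟩, h3, h4⟩ := h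
  simp only [lor] at h1 h3 h4
  simp only [lor, Pi.add_apply, Pi.sub_apply]
  linear_combination h1 - h3

lemma lor_smul_smul (c d : ℝ) (x y : L4) : lor (c • x) (d • y) = c * d * lor x y := by
  simp only [lor, Pi.smul_apply, smul_eq_mul]; ring

lemma piHat_eq {u w : UH3} {c d : ℝ} (hc : 0 < c)
    (ha : u.1.1 + u.1.2 = c • (w.1.1 + w.1.2)) (hb : u.1.1 - u.1.2 = d • (w.1.1 - w.1.2)) :
    piHat u = piHat w := by
  have hcd : c * d = 1 := by
    have h1 := lor_add_sub u.2
    rw [ha, hb, lor_smul_smul, lor_add_sub w.2] at h1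
    linarith
  apply Quotient.sound
  refine ⟨-Real.log c, fun t => ?_⟩
  change hypLine u.1 (t + -Real.log c) = hypLine w.1 t
  ext i
  have h1 := congrFun ha i
  have h2 := congrFun hb i
  simp only [Pi.add_apply, Pi.sub_apply, Pi.smul_apply, smul_eq_mul] at h1 h2
  have e1 : Real.exp (t + -Real.log c) = Real.exp t * c⁻¹ := by
    rw [Real.exp_add, Real.exp_neg, Real.exp_log hc]
  have e2 : Real.exp (-2 * (t + -Real.log c)) = Real.exp (-2 * t) * c ^ 2 := by
    rw [show -2 * (t + -Real.log c) = -2 * t + (Real.log c + Real.log c) by ring, Real.exp_add,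
      Real.exp_add, Real.exp_log hc]; ring
  rw [hypLine_coord, hypLine_coord, h1, h2, e1, e2]
  generalize Real.exp (-2 * t) = E
  field_simp
  linear_combination E * (w.1.1 i - w.1.2 i) * hcd

/-- A future null vector representing a point of `ℂ ∪ {∞}`. -/
def nullVec (e : OnePoint ℂ) : L4 :=
  e.elim ![1, 0, 0, 1] (fun z => ![1 + Complex.normSq z, 2 * z.re, 2 * z.im, Complex.normSq z - 1])

lemma nullVec_pos (e : OnePoint ℂ) : 0 < nullVec e 0 := by
  induction e using OnePoint.rec with
  | infty => simp [nullVec]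
  | coe z =>
    have := Complex.normSq_nonneg z
    simp [nullVec]; linarith

lemma nullVec_null (e : OnePoint ℂ) : lor (nullVec e) (nullVec e) = 0 := by
  induction e using OnePoint.rec with
  | infty => simp [nullVec, lor]
  | coe z => simp [nullVec, lor, Complex.normSq_apply]; ring

lemma nullVec_lor {e f : OnePoint ℂ} (h : e ≠ f) : lor (nullVec e) (nullVec f) < 0 := by
  induction e using OnePoint.rec with
  | infty =>
    induction f using OnePoint.rec with
    | infty => exact absurd rfl h
    | coe z => simp [nullVec, lor]; linarith
  | coe z =>
    induction f using OnePoint.rec with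
    | infty => simp [nullVec, lor]; linarith
    | coe w =>
      have hzw : z - w ≠ 0 := fun h' => h (by rw [sub_eq_zero.1 h'])
      have := Complex.normSq_pos.2 hzw
      simp [nullVec, lor]
      simp only [Complex.normSq_apply, Complex.sub_re, Complex.sub_im] at *
      nlinarith

lemma nullPt_nullVec (e : OnePoint ℂ) : nullPt (nullVec e) = e := by
  induction e using OnePoint.rec with
  | infty => simp [nullVec, nullPt]
  | coe z =>
    have h : nullVec (z : OnePoint ℂ) 0 - nullVec (z : OnePoint ℂ) 3 ≠ 0 := by
      simp only [nullVec, OnePoint.elim_some, Matrix.cons_val]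
      intro h
      linarith
    rw [nullPt, if_neg h]
    congr 1
    simp [nullVec]
    rw [show (1 + (Complex.normSq z : ℂ) - (Complex.normSq z - 1)) = 2 by ring]
    conv_rhs => rw [← Complex.re_add_im z]
    ring

lemma eq_smul_nullVec {n : L4} (h : lor n n = 0) (h0 : 0 < n 0) :
    ∃ c : ℝ, 0 < c ∧ n = c • nullVec (nullPt n) := by
  simp only [lor] at h
  by_cases h3 : n 0 - n 3 = 0
  · rw [nullPt, if_pos h3]
    refine ⟨n 0, h0, ?_⟩
    have e3 : n 3 = n 0 := by linarith
    rw [e3] at h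
    have e1 : n 1 = 0 := by nlinarith [sq_nonneg (n 1), sq_nonneg (n 2)]
    have e2 : n 2 = 0 := by nlinarith [sq_nonneg (n 1), sq_nonneg (n 2)]
    ext i
    fin_cases i <;> simp [nullVec, e1, e2, e3]
  · rw [nullPt, if_neg h3]
    have hp : 0 < n 0 - n 3 := by
      refine lt_of_le_of_ne ?_ (Ne.symm h3)
      nlinarith [sq_nonneg (n 1), sq_nonneg (n 2)]
    refine ⟨(n 0 - n 3) / 2, by positivity, ?_⟩
    have ez : ((n 1 : ℂ) + Complex.I * (n 2 : ℂ)) / ((n 0 : ℂ) - (n 3 : ℂ)) =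
        ⟨n 1 / (n 0 - n 3), n 2 / (n 0 - n 3)⟩ := by
      rw [← Complex.ofReal_sub]
      apply Complex.ext
      · rw [Complex.div_ofReal_re]; simp
      · rw [Complex.div_ofReal_im]; simp
    rw [ez]
    ext i
    fin_cases i <;> simp [nullVec, Complex.normSq_apply] <;> field_simp <;> nlinarith

lemma endPlus_ne_endMinus (x : LH3) : endPlus x ≠ endMinus x := by
  obtain ⟨u, rfl⟩ := piHat_surjective x
  have hf := abs_lt.1 (fut (p := u.1.1) (v := u.1.2) u.2)
  obtain ⟨c, hc, ha⟩ := eq_smul_nullVec (null_add u.2) (by simp only [Pi.add_apply]; linarith)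
  obtain ⟨d, hd, hb⟩ := eq_smul_nullVec (null_sub u.2) (by simp only [Pi.sub_apply]; linarith)
  rw [endPlus_piHat, endMinus_piHat]
  intro h
  have h2 := lor_add_sub u.2
  rw [ha, hb, lor_smul_smul, h, nullVec_null] at h2
  norm_num at h2

/-- A point of `UH3` on the geodesic with given endpoints. -/
def vecOfEnds (e f : OnePoint ℂ) : L4 × L4 :=
  ((1 / Real.sqrt (-2 * lor (nullVec e) (nullVec f))) • (nullVec e + nullVec f),
    (1 / Real.sqrt (-2 * lor (nullVec e) (nullVec f))) • (nullVec e - nullVec f))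

lemma vecOfEnds_mem {e f : OnePoint ℂ} (h : e ≠ f) : vecOfEnds e f ∈ UH3 := by
  have hl := nullVec_lor h
  have hs : 0 < -2 * lor (nullVec e) (nullVec f) := by linarith
  have hsq := Real.sq_sqrt hs.le
  have hp := Real.sqrt_pos.2 hs
  simp only [vecOfEnds]
  set s := Real.sqrt (-2 * lor (nullVec e) (nullVec f))
  have h1 := nullVec_null e
  have h2 := nullVec_null f
  have key : (1 / s) * (1 / s) * (2 * lor (nullVec e) (nullVec f)) = -1 := by
    field_simp; linarith
  have p1 := nullVec_pos e
  have p2 := nullVec_pos f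
  refine ⟨⟨?_, ?_⟩, ?_, ?_⟩
  · rw [lor_smul_smul, ← key]
    congr 1
    simp only [lor, Pi.add_apply] at *
    linear_combination h1 + h2
  · simp only [Pi.smul_apply, Pi.add_apply, smul_eq_mul]; positivity
  · have h3 : lor (nullVec e - nullVec f) (nullVec e - nullVec f) =
        -(2 * lor (nullVec e) (nullVec f)) := by
      simp only [lor, Pi.sub_apply] at *
      linear_combination h1 + h2
    rw [lor_smul_smul, h3]
    linear_combination -key
  · rw [lor_smul_smul]
    have : lor (nullVec e + nullVec f) (nullVec e - nullVec f) = 0 := by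
      simp only [lor, Pi.sub_apply, Pi.add_apply] at *
      linear_combination h1 - h2
    rw [this, mul_zero]

lemma vecOfEnds_add (e f : OnePoint ℂ) : (vecOfEnds e f).1 + (vecOfEnds e f).2 =
    (2 * (1 / Real.sqrt (-2 * lor (nullVec e) (nullVec f)))) • nullVec e := by
  ext i
  simp only [vecOfEnds, Pi.add_apply, Pi.sub_apply, Pi.smul_apply, smul_eq_mul]; ring

lemma vecOfEnds_sub (e f : OnePoint ℂ) : (vecOfEnds e f).1 - (vecOfEnds e f).2 =
    (2 * (1 / Real.sqrt (-2 * lor (nullVec e) (nullVec f)))) • nullVec f := by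
  ext i
  simp only [vecOfEnds, Pi.add_apply, Pi.sub_apply, Pi.smul_apply, smul_eq_mul]; ring

lemma vecOfEnds_pos {e f : OnePoint ℂ} (h : e ≠ f) :
    0 < 2 * (1 / Real.sqrt (-2 * lor (nullVec e) (nullVec f))) := by
  have hl := nullVec_lor h
  have := Real.sqrt_pos.2 (show 0 < -2 * lor (nullVec e) (nullVec f) by linarith)
  positivity

open Classical in
/-- The oriented geodesic `[γ]` with `γ₊ = e` and `γ₋ = f`, for `e ≠ f` (junk for `e = f`). -/
def ofEnds (e f : OnePoint ℂ) : LH3 :=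
  if h : e ≠ f then piHat ⟨vecOfEnds e f, vecOfEnds_mem h⟩
  else piHat ⟨vecOfEnds OnePoint.infty (0 : ℂ), vecOfEnds_mem (OnePoint.infty_ne_coe _)⟩

lemma endPlus_ofEnds {e f : OnePoint ℂ} (h : e ≠ f) : endPlus (ofEnds e f) = e := by
  rw [ofEnds, dif_pos h, endPlus_piHat, vecOfEnds_add, nullPt_smul (vecOfEnds_pos h),
    nullPt_nullVec]

lemma endMinus_ofEnds {e f : OnePoint ℂ} (h : e ≠ f) : endMinus (ofEnds e f) = f := by
  rw [ofEnds, dif_pos h, endMinus_piHat, vecOfEnds_sub, nullPt_smul (vecOfEnds_pos h),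
    nullPt_nullVec]

lemma ofEnds_end (x : LH3) : ofEnds (endPlus x) (endMinus x) = x := by
  have hne := endPlus_ne_endMinus x
  rw [ofEnds, dif_pos hne]
  obtain ⟨u, rfl⟩ := piHat_surjective x
  have hf := abs_lt.1 (fut (p := u.1.1) (v := u.1.2) u.2)
  obtain ⟨c, hc, ha⟩ := eq_smul_nullVec (null_add u.2) (by simp only [Pi.add_apply]; linarith)
  obtain ⟨d, hd, hb⟩ := eq_smul_nullVec (null_sub u.2) (by simp only [Pi.sub_apply]; linarith)
  have hk := vecOfEnds_pos hne
  rw [← endPlus_piHat] at ha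
  rw [← endMinus_piHat] at hb
  symm
  apply piHat_eq (c := c / (2 * (1 / Real.sqrt (-2 * lor (nullVec (endPlus (piHat u)))
      (nullVec (endMinus (piHat u)))))))
    (d := d / (2 * (1 / Real.sqrt (-2 * lor (nullVec (endPlus (piHat u)))
      (nullVec (endMinus (piHat u))))))) (by positivity)
  · rw [vecOfEnds_add, smul_smul, div_mul_cancel₀ _ hk.ne', ← ha]
  · rw [vecOfEnds_sub, smul_smul, div_mul_cancel₀ _ hk.ne', ← hb]

/-- The map `z ↦ 1 / z̄` from `ℂ` to `ℂ ∪ {∞}`. -/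
def invConj (z : ℂ) : OnePoint ℂ := if z = 0 then OnePoint.infty else (((conj z)⁻¹ : ℂ) : OnePoint ℂ)

/-- The map `z ↦ -1 / z` from `ℂ` to `ℂ ∪ {∞}`. -/
def negInv (z : ℂ) : OnePoint ℂ := if z = 0 then OnePoint.infty else ((-z⁻¹ : ℂ) : OnePoint ℂ)

lemma invConj_ne {z₁ z₂ : ℂ} (h : 1 + z₁ * conj z₂ ≠ 0) :
    invConj z₂ ≠ ((-z₁ : ℂ) : OnePoint ℂ) := by
  unfold invConj
  split_ifs with h0
  · exact OnePoint.infty_ne_coe _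
  · intro h1
    have h1 := OnePoint.coe_injective h1
    have h0' : conj z₂ ≠ 0 := by simpa using h0
    apply h
    have : z₁ = -(conj z₂)⁻¹ := by rw [h1]; ring
    rw [this]; field_simp; ring

lemma ne_negInv {z₁ z₂ : ℂ} (h : 1 + z₁ * conj z₂ ≠ 0) :
    ((conj z₂ : ℂ) : OnePoint ℂ) ≠ negInv z₁ := by
  unfold negInv
  split_ifs with h0
  · exact OnePoint.coe_ne_infty _
  · intro h1
    have h1 := OnePoint.coe_injective h1
    apply h
    rw [h1]; field_simp; ring

/-- The coordinate system `(μ₁, μ₂) = (-γ₋, 1 / conj γ₊)` on the set of those `[γ]` with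
`γ₊ ≠ 0` and `γ₋ ≠ ∞`. -/
def muChart : PartialEquiv LH3 (ℂ × ℂ) where
  toFun x := ((endMinus x).elim 0 (fun z => -z), (endPlus x).elim 0 (fun z => (conj z)⁻¹))
  invFun z := ofEnds (invConj z.2) ((-z.1 : ℂ) : OnePoint ℂ)
  source := {x | endPlus x ≠ ((0 : ℂ) : OnePoint ℂ) ∧ endMinus x ≠ OnePoint.infty}
  target := {z | 1 + z.1 * conj z.2 ≠ 0}
  map_source' := by
    rintro x ⟨h1, h2⟩
    have hne := endPlus_ne_endMinus x
    revert h1 h2 hne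
    generalize endPlus x = e
    generalize endMinus x = f
    intro h1 h2 hne
    induction f using OnePoint.rec with
    | infty => exact absurd rfl h2
    | coe w =>
      induction e using OnePoint.rec with
      | infty => simp
      | coe z =>
        have hz : z ≠ 0 := fun h => h1 (by rw [h])
        have hzw : z ≠ w := fun h => hne (by rw [h])
        simp only [OnePoint.elim_some, Set.mem_ofPred_eq, map_inv₀, Complex.conj_conj]
        intro h
        field_simp at h
        exact hzw (by linear_combination h)
  map_target' := by
    intro z hz
    have h := invConj_ne hz
    refine ⟨?_, ?_⟩
    · rw [endPlus_ofEnds h]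
      unfold invConj
      split_ifs with h0
      · exact OnePoint.infty_ne_coe _
      · intro h1
        have h1 := OnePoint.coe_injective h1
        simp [h0] at h1
    · rw [endMinus_ofEnds h]
      exact OnePoint.coe_ne_infty _
  left_inv' := by
    rintro x ⟨h1, h2⟩
    conv_rhs => rw [← ofEnds_end x]
    revert h1 h2
    generalize endPlus x = e
    generalize endMinus x = f
    intro h1 h2
    induction f using OnePoint.rec with
    | infty => exact absurd rfl h2
    | coe w =>
      induction e using OnePoint.rec with
      | infty => simp [invConj]
      | coe z =>
        have hz : z ≠ 0 := fun h => h1 (by rw [h])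
        simp [invConj, hz]
  right_inv' := by
    intro z hz
    have h := invConj_ne hz
    rw [endPlus_ofEnds h, endMinus_ofEnds h]
    refine Prod.ext (by simp) ?_
    simp only [invConj]
    split_ifs with h0
    · simp [h0]
    · simp

/-- The coordinate system `(1 / μ₁, 1 / μ₂) = (-1 / γ₋, conj γ₊)` on the set of those `[γ]` with
`γ₊ ≠ ∞` and `γ₋ ≠ 0`. -/
def muInvChart : PartialEquiv LH3 (ℂ × ℂ) where
  toFun x := ((endMinus x).elim 0 (fun z => -z⁻¹), (endPlus x).elim 0 (fun z => conj z))
  invFun z := ofEnds ((conj z.2 : ℂ) : OnePoint ℂ) (negInv z.1)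
  source := {x | endPlus x ≠ OnePoint.infty ∧ endMinus x ≠ ((0 : ℂ) : OnePoint ℂ)}
  target := {z | 1 + z.1 * conj z.2 ≠ 0}
  map_source' := by
    rintro x ⟨h1, h2⟩
    have hne := endPlus_ne_endMinus x
    revert h1 h2 hne
    generalize endPlus x = e
    generalize endMinus x = f
    intro h1 h2 hne
    induction e using OnePoint.rec with
    | infty => exact absurd rfl h1
    | coe w =>
      induction f using OnePoint.rec with
      | infty => simp
      | coe z =>
        have hz : z ≠ 0 := fun h => h2 (by rw [h])
        have hzw : w ≠ z := fun h => hne (by rw [h])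
        simp only [OnePoint.elim_some, Set.mem_ofPred_eq, Complex.conj_conj]
        intro h
        field_simp at h
        exact hzw (by linear_combination -h)
  map_target' := by
    intro z hz
    have h := ne_negInv hz
    refine ⟨?_, ?_⟩
    · rw [endPlus_ofEnds h]
      exact OnePoint.coe_ne_infty _
    · rw [endMinus_ofEnds h]
      unfold negInv
      split_ifs with h0
      · exact OnePoint.infty_ne_coe _
      · intro h1
        have h1 := OnePoint.coe_injective h1
        simp [h0] at h1
  left_inv' := by
    rintro x ⟨h1, h2⟩
    conv_rhs => rw [← ofEnds_end x]
    revert h1 h2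
    generalize endPlus x = e
    generalize endMinus x = f
    intro h1 h2
    induction e using OnePoint.rec with
    | infty => exact absurd rfl h1
    | coe w =>
      induction f using OnePoint.rec with
      | infty => simp [negInv]
      | coe z =>
        have hz : z ≠ 0 := fun h => h2 (by rw [h])
        simp [negInv, hz]
  right_inv' := by
    intro z hz
    have h := ne_negInv hz
    rw [endPlus_ofEnds h, endMinus_ofEnds h]
    refine Prod.ext ?_ (by simp)
    simp only [negInv]
    split_ifs with h0
    · simp [h0]
    · simp

lemma mem_muInvChart_of_notMem {x : LH3} (h : x ∉ muChart.source) : x ∈ muInvChart.source := by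
  have hne := endPlus_ne_endMinus x
  by_cases h1 : endPlus x = ((0 : ℂ) : OnePoint ℂ)
  · exact ⟨by rw [h1]; exact OnePoint.coe_ne_infty _, fun h2 => hne (by rw [h1, h2])⟩
  · have h2 : endMinus x = OnePoint.infty := by
      by_contra h2
      exact h ⟨h1, h2⟩
    exact ⟨fun h3 => hne (by rw [h2, h3]), by rw [h2]; exact OnePoint.infty_ne_coe _⟩

/-- The change of coordinates. -/
def invMap (z : ℂ × ℂ) : ℂ × ℂ := (z.1⁻¹, z.2⁻¹)

/-- The domain of the change of coordinates. -/
def transDom : Set (ℂ × ℂ) := {z | 1 + z.1 * conj z.2 ≠ 0 ∧ z.1 ≠ 0 ∧ z.2 ≠ 0}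

lemma isOpen_target : IsOpen {z : ℂ × ℂ | 1 + z.1 * conj z.2 ≠ 0} :=
  isOpen_ne_fun (by fun_prop) continuous_const

lemma isOpen_transDom : IsOpen transDom :=
  isOpen_target.inter ((isOpen_ne_fun continuous_fst continuous_const).inter
    (isOpen_ne_fun continuous_snd continuous_const))

lemma trans_source : (muChart.symm.trans muInvChart).source = transDom := by
  ext z
  rw [PartialEquiv.trans_source]
  constructor
  · rintro ⟨hz, h1, h2⟩
    have hne := invConj_ne hz
    change endPlus (ofEnds _ _) ≠ _ at h1
    change endMinus (ofEnds _ _) ≠ _ at h2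
    rw [endPlus_ofEnds hne] at h1
    rw [endMinus_ofEnds hne] at h2
    refine ⟨hz, fun h => h2 (by rw [h, neg_zero]), fun h => h1 (by simp [invConj, h])⟩
  · rintro ⟨hz, h1, h2⟩
    have hne := invConj_ne hz
    refine ⟨hz, ?_, ?_⟩
    · change endPlus (ofEnds _ _) ≠ _
      rw [endPlus_ofEnds hne]; simp [invConj, h2]
    · change endMinus (ofEnds _ _) ≠ _
      rw [endMinus_ofEnds hne]
      intro h
      exact h1 (neg_eq_zero.1 (OnePoint.coe_injective h))

lemma trans_source' : (muInvChart.symm.trans muChart).source = transDom := by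
  ext z
  rw [PartialEquiv.trans_source]
  constructor
  · rintro ⟨hz, h1, h2⟩
    have hne := ne_negInv hz
    change endPlus (ofEnds _ _) ≠ _ at h1
    change endMinus (ofEnds _ _) ≠ _ at h2
    rw [endPlus_ofEnds hne] at h1
    rw [endMinus_ofEnds hne] at h2
    refine ⟨hz, fun h => h2 (by simp [negInv, h]), fun h => h1 (by rw [h, map_zero])⟩
  · rintro ⟨hz, h1, h2⟩
    have hne := ne_negInv hz
    refine ⟨hz, ?_, ?_⟩
    · change endPlus (ofEnds _ _) ≠ _
      rw [endPlus_ofEnds hne]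
      intro h
      exact h2 (by simpa using OnePoint.coe_injective h)
    · change endMinus (ofEnds _ _) ≠ _
      rw [endMinus_ofEnds hne]; simp [negInv, h1]

lemma trans_eq : Set.EqOn (muChart.symm.trans muInvChart) invMap transDom := by
  rintro z ⟨hz, h1, h2⟩
  have hne := invConj_ne hz
  change ((endMinus (ofEnds _ _)).elim 0 _, (endPlus (ofEnds _ _)).elim 0 _) = _
  rw [endPlus_ofEnds hne, endMinus_ofEnds hne]
  simp [invConj, h2, invMap, inv_neg]

lemma trans_eq' : Set.EqOn (muInvChart.symm.trans muChart) invMap transDom := by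
  rintro z ⟨hz, h1, h2⟩
  have hne := ne_negInv hz
  change ((endMinus (ofEnds _ _)).elim 0 _, (endPlus (ofEnds _ _)).elim 0 _) = _
  rw [endPlus_ofEnds hne, endMinus_ofEnds hne]
  simp [negInv, h1, invMap]

lemma contDiffOn_invMap : ContDiffOn ℝ ∞ invMap transDom := by
  have h : ∀ w : ℂ, w ≠ 0 → ContDiffAt ℝ ∞ (fun w : ℂ => w⁻¹) w := fun w hw =>
    contDiffAt_inv ℝ hw
  intro z hz
  exact (((h _ hz.2.1).comp z contDiffAt_fst).prodMk
    ((h _ hz.2.2).comp z contDiffAt_snd)).contDiffWithinAt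

lemma symm_trans_self_source (e : PartialEquiv LH3 (ℂ × ℂ)) :
    (e.symm.trans e).source = e.target := by
  rw [PartialEquiv.trans_source]
  ext z
  exact ⟨fun h => h.1, fun h => ⟨h, e.map_target h⟩⟩

lemma trans_cases {e e' : PartialEquiv LH3 (ℂ × ℂ)}
    (he : e ∈ ({muChart, muInvChart} : Set (PartialEquiv LH3 (ℂ × ℂ))))
    (he' : e' ∈ ({muChart, muInvChart} : Set (PartialEquiv LH3 (ℂ × ℂ)))) :
    IsOpen (e.symm.trans e').source ∧
      ContDiffOn ℝ ∞ (e.symm.trans e') (e.symm.trans e').source := by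
  have self : ∀ e : PartialEquiv LH3 (ℂ × ℂ),
      ContDiffOn ℝ ∞ (e.symm.trans e) (e.symm.trans e).source := by
    intro e
    rw [symm_trans_self_source]
    exact contDiffOn_id.congr fun z hz => e.right_inv hz
  rcases he with rfl | rfl <;> rcases he' with rfl | rfl
  · exact ⟨by rw [symm_trans_self_source]; exact isOpen_target, self _⟩
  · rw [trans_source]
    exact ⟨isOpen_transDom, contDiffOn_invMap.congr trans_eq⟩
  · rw [trans_source']
    exact ⟨isOpen_transDom, contDiffOn_invMap.congr trans_eq'⟩
  · exact ⟨by rw [symm_trans_self_source]; exact isOpen_target, self _⟩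

open Classical in
/-- The smooth structure of `LH3` given by the coordinate systems `(μ₁, μ₂)` and
`(1 / μ₁, 1 / μ₂)`, whose domains cover `LH3`. -/
def lh3Core : ChartedSpaceCore (ℂ × ℂ) LH3 where
  atlas := {muChart, muInvChart}
  chartAt x := if x ∈ muChart.source then muChart else muInvChart
  mem_chart_source x := by
    split_ifs with h
    · exact h
    · exact mem_muInvChart_of_notMem h
  chart_mem_atlas x := by
    split_ifs
    · exact Or.inl rfl
    · exact Or.inr rfl
  open_source _ _ he he' := (trans_cases he he').1
  continuousOn_toFun _ _ he he' := (trans_cases he he').2.continuousOn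

instance : TopologicalSpace LH3 := lh3Core.toTopologicalSpace

instance : ChartedSpace (ℂ × ℂ) LH3 := lh3Core.toChartedSpace

instance : IsManifold 𝓘(ℝ, ℂ × ℂ) ∞ LH3 := by
  apply isManifold_of_contDiffOn
  intro e e' he he'
  obtain ⟨f, hf, rfl⟩ : ∃ f, ∃ hf : f ∈ lh3Core.atlas, lh3Core.openPartialHomeomorph f hf = e := by
    have := Set.mem_iUnion₂.1 he
    obtain ⟨f, hf, h⟩ := this
    exact ⟨f, hf, h.symm⟩
  obtain ⟨f', hf', rfl⟩ : ∃ f, ∃ hf : f ∈ lh3Core.atlas,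
      lh3Core.openPartialHomeomorph f hf = e' := by
    have := Set.mem_iUnion₂.1 he'
    obtain ⟨f, hf, h⟩ := this
    exact ⟨f, hf, h.symm⟩
  have h := (trans_cases hf hf').2
  simp only [modelWithCornersSelf_coe, modelWithCornersSelf_coe_symm, Set.range_id,
    Set.inter_univ, Set.preimage_id, Function.comp_id, Function.id_comp]
  exact h

/-- The tangent space of `LH3` at `x`, a real vector space of dimension `4`. -/
abbrev TLH3 (x : LH3) : Type := TangentSpace 𝓘(ℝ, ℂ × ℂ) x

/-- The differential `X ↦ (dμ₁(X), dμ₂(X))` at `x` of the coordinate system `(μ₁, μ₂)` (the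
preferred chart `chartAt (ℂ × ℂ) x`, that is `muChart` on its domain, and `muInvChart` elsewhere;
tangent vectors at `x` are by definition given by their components in this chart). -/
def dmu (x : LH3) : TLH3 x ≃L[ℝ] ℂ × ℂ := ContinuousLinearEquiv.refl ℝ (ℂ × ℂ)

lemma dmu_eq_mfderiv (x : LH3) :
    (dmu x : TLH3 x →L[ℝ] ℂ × ℂ) =
      mfderiv 𝓘(ℝ, ℂ × ℂ) 𝓘(ℝ, ℂ × ℂ) (chartAt (ℂ × ℂ) x) x := by
  have : IsManifold 𝓘(ℝ, ℂ × ℂ) 1 LH3 := IsManifold.of_le (n := ∞) (by simp)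
  rw [mfderiv_chartAt_eq_tangentCoordChange (I := 𝓘(ℝ, ℂ × ℂ)) (mem_chart_source (ℂ × ℂ) x)]
  exact ContinuousLinearMap.ext fun v =>
    (tangentCoordChange_self (I := 𝓘(ℝ, ℂ × ℂ)) (mem_extChartAt_source x)).symm

/-- The value at `(X, Y)` of the symmetric tensor `4 dμ₁ dμ̄₂ / (1 + μ₁ μ̄₂)²`, in coordinates: `z` is
the base point `(μ₁, μ₂)`, and `dμ₁ dμ̄₂` is the symmetric product, so that
`(dμ₁ dμ̄₂)(X, X) = dμ₁(X) dμ̄₂(X)`. -/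
def coordG (z X Y : ℂ × ℂ) : ℂ :=
  4 * ((X.1 * conj Y.2 + Y.1 * conj X.2) / 2) / (1 + z.1 * conj z.2) ^ 2

/-- The expression of the tensor is the same in the coordinates `(1 / μ₁, 1 / μ₂)`. -/
lemma coordG_invMap {z : ℂ × ℂ} (hz : z ∈ transDom) (X Y : ℂ × ℂ) :
    coordG (invMap z) (-X.1 / z.1 ^ 2, -X.2 / z.2 ^ 2) (-Y.1 / z.1 ^ 2, -Y.2 / z.2 ^ 2) =
      coordG z X Y := by
  obtain ⟨h, h1, h2⟩ := hz
  have h2' : conj z.2 ≠ 0 := by simpa using h2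
  have h3 : z.1 * conj z.2 + 1 ≠ 0 := by rwa [add_comm]
  simp only [coordG, invMap, map_div₀, map_neg, map_pow, map_inv₀]
  have e : 1 + z.1⁻¹ * (conj z.2)⁻¹ = (1 + z.1 * conj z.2) / (z.1 * conj z.2) := by
    field_simp
    ring
  rw [e]
  field_simp

/-- The `ℂ`-valued symmetric `2`-tensor `𝓖 = 4 dμ₁ dμ̄₂ / (1 + μ₁ μ̄₂)²` on `LH3`. -/
def G (x : LH3) (X Y : TLH3 x) : ℂ := coordG (chartAt (ℂ × ℂ) x x) (dmu x X) (dmu x Y)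

/-- The real part of `G`, a neutral metric. -/
def Gr (x : LH3) (X Y : TLH3 x) : ℝ := (G x X Y).re

/-- The imaginary part of `G`, a neutral metric. -/
def Gi (x : LH3) (X Y : TLH3 x) : ℝ := (G x X Y).im

/-- The complex structure, `J (∂/∂μ₁) = i ∂/∂μ₁`, `J (∂/∂μ₂) = i ∂/∂μ₂`. -/
def J (x : LH3) (X : TLH3 x) : TLH3 x :=
  (dmu x).symm (Complex.I * (dmu x X).1, Complex.I * (dmu x X).2)

/-- The para-complex structure, `P (∂/∂μ₁) = -∂/∂μ₁`, `P (∂/∂μ₂) = ∂/∂μ₂`. -/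
def P (x : LH3) (X : TLH3 x) : TLH3 x := (dmu x).symm (-(dmu x X).1, (dmu x X).2)

/-- The Kähler form of `(Gi, J)`. -/
def omegaJ (x : LH3) (X Y : TLH3 x) : ℝ := Gi x X (J x Y)

/-- The para-Kähler form of `(Gr, P)`. -/
def omegaP (x : LH3) (X Y : TLH3 x) : ℝ := Gr x X (P x Y)

/-- The tangent space of `UH3` at `u = (p, v)`, as a subspace of `L4 × L4`. -/
def tangentUH3 (u : UH3) : Submodule ℝ (L4 × L4) where
  carrier := {ξ | lor u.1.1 ξ.1 = 0 ∧ lor u.1.2 ξ.2 = 0 ∧ lor u.1.1 ξ.2 = -lor ξ.1 u.1.2}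
  zero_mem' := by simp [lor]
  add_mem' := by
    rintro ξ η ⟨h1, h2, h3⟩ ⟨k1, k2, k3⟩
    simp only [lor] at h1 h2 h3 k1 k2 k3
    refine ⟨?_, ?_, ?_⟩ <;> simp only [lor, Prod.fst_add, Prod.snd_add, Pi.add_apply]
    · linear_combination h1 + k1
    · linear_combination h2 + k2
    · linear_combination h3 + k3
  smul_mem' := by
    rintro c ξ ⟨h1, h2, h3⟩
    simp only [lor] at h1 h2 h3
    refine ⟨?_, ?_, ?_⟩ <;> simp only [lor, Prod.smul_fst, Prod.smul_snd, Pi.smul_apply, smul_eq_mul]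
    · linear_combination c * h1
    · linear_combination c * h2
    · linear_combination c * h3

/-- The `1`-form `(X, V) ↦ ⟨X, v⟩` at `(p, v)` on `L4 × L4`. Its restriction to `UH3` is the
canonical contact form `Θ`. -/
def contactForm (u : L4 × L4) : (L4 × L4) [⋀^Fin 1]→L[ℝ] ℝ :=
  ContinuousAlternatingMap.ofSubsingleton ℝ (L4 × L4) ℝ (0 : Fin 1)
    (LinearMap.toContinuousLinearMap
      { toFun := fun ξ => lor ξ.1 u.2
        map_add' := fun ξ η => by simp only [lor, Prod.fst_add, Pi.add_apply]; ring
        map_smul' := fun c ξ => by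
          simp only [lor, Prod.smul_fst, Pi.smul_apply, smul_eq_mul, RingHom.id_apply]; ring })

/-- The exterior derivative `dΘ` of the canonical contact form of `UH3`, with the convention
`dΘ(X, Y) = (X(Θ(Y)) - Y(Θ(X)) - Θ([X, Y])) / 2`. As exterior derivatives commute with restriction
to submanifolds, this is the restriction to `UH3` of the derivative of `contactForm`
(the convention of `extDeriv` has no factor `1 / 2`). -/
def dTheta (u : UH3) : (tangentUH3 u) [⋀^Fin 2]→L[ℝ] ℝ :=
  ((1 / 2 : ℝ) • extDeriv contactForm u.1).compContinuousLinearMap (tangentUH3 u).subtypeL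

lemma hasFDerivAt_lor {f g : ℝ × ℝ → L4} {f' g' : ℝ × ℝ →L[ℝ] L4} {s : ℝ × ℝ}
    (hf : HasFDerivAt f f' s) (hg : HasFDerivAt g g' s) (a : ℝ × ℝ) {c : ℝ}
    (h : ∀ s, lor (f s) (g s) = c) : lor (f' a) (g s) + lor (f s) (g' a) = 0 := by
  have hl : HasDerivAt (fun t : ℝ => s + t • a) a 0 := by
    simpa using ((hasDerivAt_id (0 : ℝ)).smul_const a).const_add s
  have hs : s + (0 : ℝ) • a = s := by simp
  have hf' := HasFDerivAt.comp_hasDerivAt (f := fun t : ℝ => s + t • a) (0 : ℝ)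
    (by rw [hs]; exact hf) hl
  have hg' := HasFDerivAt.comp_hasDerivAt (f := fun t : ℝ => s + t • a) (0 : ℝ)
    (by rw [hs]; exact hg) hl
  have k := hasDerivAt_lor hf' hg'
  have e : (fun t : ℝ => lor ((f ∘ fun t : ℝ => s + t • a) t) ((g ∘ fun t : ℝ => s + t • a) t)) =
      fun _ => c := funext fun t => h _
  rw [e] at k
  have := k.unique (hasDerivAt_const (0 : ℝ) c)
  simpa using this

lemma fderiv_mem_tangentUH3 {φ : ℝ × ℝ → UH3} {s : ℝ × ℝ}
    (h : ContDiffAt ℝ ∞ (fun r => (φ r : L4 × L4)) s) (a : ℝ × ℝ) :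
    fderiv ℝ (fun r => (φ r : L4 × L4)) s a ∈ tangentUH3 (φ s) := by
  have hd := (h.differentiableAt (by simp)).hasFDerivAt
  have hp := hd.fst
  have hv := hd.snd
  have h1 := hasFDerivAt_lor hp hp a fun r => (φ r).2.1.1
  have h2 := hasFDerivAt_lor hv hv a fun r => (φ r).2.2.1
  have h3 := hasFDerivAt_lor hp hv a fun r => (φ r).2.2.2
  refine ⟨?_, ?_, ?_⟩
  · rw [lor_comm] at h1
    linarith! [h1]
  · rw [lor_comm] at h2
    linarith! [h2]
  · linarith! [h3]

/-- The differential at `s` of a map `φ : ℝ² → UH3` which is smooth at `s`. -/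
def pushUH3 {φ : ℝ × ℝ → UH3} {s : ℝ × ℝ} (h : ContDiffAt ℝ ∞ (fun r => (φ r : L4 × L4)) s)
    (a : ℝ × ℝ) : tangentUH3 (φ s) :=
  ⟨fderiv ℝ (fun r => (φ r : L4 × L4)) s a, fderiv_mem_tangentUH3 h a⟩

/-- Differential `2`-forms on `LH3`. -/
abbrev TwoForm : Type := ∀ x : LH3, (TLH3 x) [⋀^Fin 2]→L[ℝ] ℝ

/-- The expression of a `2`-form in a chart. -/
def chartExpr (om : TwoForm) (e : OpenPartialHomeomorph LH3 (ℂ × ℂ)) (z : ℂ × ℂ) :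
    (ℂ × ℂ) [⋀^Fin 2]→L[ℝ] ℝ :=
  (om (e.symm z)).compContinuousLinearMap (mfderiv 𝓘(ℝ, ℂ × ℂ) 𝓘(ℝ, ℂ × ℂ) e.symm z)

/-- Symplectic forms on `LH3`: smooth closed nondegenerate `2`-forms. -/
structure IsSymplectic (om : TwoForm) : Prop where
  smooth : ∀ e ∈ atlas (ℂ × ℂ) LH3, ContDiffOn ℝ ∞ (chartExpr om e) e.target
  closed : ∀ e ∈ atlas (ℂ × ℂ) LH3, ∀ z ∈ e.target, extDeriv (chartExpr om e) z = 0
  nondegenerate : ∀ x, ∀ X : TLH3 x, (∀ Y : TLH3 x, om x ![X, Y] = 0) → X = 0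

/-- The equality `piHat^* om = dΘ` of `2`-forms on `UH3`, tested on all tangent vectors
`dφ(a), dφ(b)` of `UH3`, where `φ : ℝ² → UH3` is any map which is smooth at `s`; then
`dpiHat(dφ(a)) = d(piHat ∘ φ)(a)`. -/
def PullbackEqDTheta (om : TwoForm) : Prop :=
  ∀ (φ : ℝ × ℝ → UH3) (s : ℝ × ℝ) (h : ContDiffAt ℝ ∞ (fun r => (φ r : L4 × L4)) s)
    (a b : ℝ × ℝ),
    om (piHat (φ s))
      ![mfderiv 𝓘(ℝ, ℝ × ℝ) 𝓘(ℝ, ℂ × ℂ) (fun r => piHat (φ r)) s a,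
        mfderiv 𝓘(ℝ, ℝ × ℝ) 𝓘(ℝ, ℂ × ℂ) (fun r => piHat (φ r)) s b] =
      dTheta (φ s) ![pushUH3 h a, pushUH3 h b]

/-- The canonical symplectic form of `LH3`: the symplectic form `om` with `piHat^* om = dΘ`. -/
def IsCanonicalSymplecticForm (om : TwoForm) : Prop := IsSymplectic om ∧ PullbackEqDTheta om

end HypGeod
end

/-!
In both coordinate systems the form sought is `Re (dz₁ ∧ dz̄₂ / (1 + z₁ z̄₂)²)`. It is closed because
it is the exterior derivative of `Re (z₁ dz̄₂ / (1 + z₁ z̄₂))`, and nondegenerate by inspection.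

To compare it with `dΘ`, replace a unit tangent vector `(p, v)` by the two null vectors `n = p + v`
and `m = p - v`, which represent the two endpoints of the geodesic. In these terms
`dΘ = (⟨n', m*⟩ - ⟨n*, m'⟩) / 4` on two variations `(n', m')` and `(n*, m*)`, while `n = a N(z₂)` and
`m = b M(z₁)`, where `N`, `M` are quadratic in the coordinates `z₁`, `z₂` of the geodesic, and the
scalars satisfy `a b |1 + z₁ z̄₂|² = 1`. The equality `piHat^* ω = dΘ` becomes a polynomial identity
modulo this relation and its derivatives (`pullback_identity`, `coordOmega_eq_dTheta`). The rotation
`diag(1, 1, -1, -1)` of `L4` induces `w ↦ 1 / w` on the ideal boundary and exchanges the two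
coordinate systems, so that both are treated at once with a sign `ε = ±1`.

Each chart has a smooth local section `sect ε` of `piHat`. As it lifts affine planes of the chart to
`UH3`, any `2`-form pulling back to `dΘ` has a prescribed expression in the chart: this yields
uniqueness (`eq_canonicalForm`), and also the fact that the expressions in the two charts define the
same form (`chartExpr_canonicalForm`). The relation with `omegaJ` and `omegaP` is then a computation
in coordinates.
-/

noncomputable section

namespace HypGeod

/-! ### The coordinate expression of the symplectic form -/

/-- The `1`-form `Re (z₁ dz̄₂ / (1 + z₁ z̄₂))` on `ℂ × ℂ` (with junk value `0` where
`1 + z₁ z̄₂ = 0`). -/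
def coordPotential (z : ℂ × ℂ) : (ℂ × ℂ) [⋀^Fin 1]→L[ℝ] ℝ :=
  ContinuousAlternatingMap.ofSubsingleton ℝ (ℂ × ℂ) ℝ (0 : Fin 1)
    (Complex.reCLM ∘L ((z.1 / (1 + z.1 * conj z.2)) •
      ((Complex.conjCLE : ℂ →L[ℝ] ℂ) ∘L ContinuousLinearMap.snd ℝ ℂ ℂ)))

/-- The exterior derivative of `coordPotential`, that is the `2`-form
`Re (dz₁ ∧ dz̄₂ / (1 + z₁ z̄₂)²)`. -/
def coordOmega (z : ℂ × ℂ) : (ℂ × ℂ) [⋀^Fin 2]→L[ℝ] ℝ := extDeriv coordPotential z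

lemma contDiffAt_coordPotential {z : ℂ × ℂ} (hz : 1 + z.1 * conj z.2 ≠ 0) :
    ContDiffAt ℝ ∞ coordPotential z := by
  have hc : ContDiffAt ℝ ∞ (fun z : ℂ × ℂ => conj z.2) z :=
    (Complex.conjCLE.contDiff.comp contDiff_snd).contDiffAt
  have h : ContDiffAt ℝ ∞ (fun z : ℂ × ℂ => z.1 / (1 + z.1 * conj z.2)) z := by
    simp only [div_eq_mul_inv]
    exact contDiffAt_fst.mul ((contDiffAt_const.add (contDiffAt_fst.mul hc)).inv hz)
  have h2 := h.smul (contDiffAt_const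
    (c := (Complex.conjCLE : ℂ →L[ℝ] ℂ) ∘L ContinuousLinearMap.snd ℝ ℂ ℂ))
  exact (ContinuousAlternatingMap.ofSubsingletonLIE (𝕜 := ℝ) (E := ℂ × ℂ) (F := ℝ)
    (0 : Fin 1)).contDiff.contDiffAt.comp z (contDiffAt_const.clm_comp h2)

lemma contDiffAt_coordOmega {z : ℂ × ℂ} (hz : 1 + z.1 * conj z.2 ≠ 0) :
    ContDiffAt ℝ ∞ coordOmega z :=
  (ContinuousAlternatingMap.alternatizeUncurryFinCLM ℝ (ℂ × ℂ) ℝ).contDiff.contDiffAt.comp z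
    ((contDiffAt_coordPotential hz).fderiv_right (by simp))

lemma extDeriv_coordOmega {z : ℂ × ℂ} (hz : 1 + z.1 * conj z.2 ≠ 0) :
    extDeriv coordOmega z = 0 :=
  extDeriv_extDeriv_apply (contDiffAt_coordPotential hz) (by simp; exact WithTop.coe_le_coe.2 le_top)

lemma coordOmega_apply {z : ℂ × ℂ} (hz : 1 + z.1 * conj z.2 ≠ 0) (X Y : ℂ × ℂ) :
    coordOmega z ![X, Y] = ((X.1 * conj Y.2 - Y.1 * conj X.2) / (1 + z.1 * conj z.2) ^ 2).re := by
  have hfst : HasFDerivAt (fun z : ℂ × ℂ => z.1) (ContinuousLinearMap.fst ℝ ℂ ℂ) z :=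
    hasFDerivAt_fst
  have hc : HasFDerivAt (fun z : ℂ × ℂ => conj z.2)
      ((Complex.conjCLE : ℂ →L[ℝ] ℂ) ∘L ContinuousLinearMap.snd ℝ ℂ ℂ) z :=
    ((Complex.conjCLE : ℂ →L[ℝ] ℂ) ∘L ContinuousLinearMap.snd ℝ ℂ ℂ).hasFDerivAt
  have hw : ∀ w : ℂ × ℂ, ∀ V : ℂ × ℂ, fderiv ℝ (fun z => coordPotential z ![w]) z V =
      ((V.1 - z.1 ^ 2 * conj V.2) / (1 + z.1 * conj z.2) ^ 2 * conj w.2).re := by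
    intro w V
    have e : (fun z => coordPotential z ![w]) = fun z : ℂ × ℂ => Complex.reCLM
        (z.1 * (1 + z.1 * conj z.2)⁻¹ * conj w.2) := by
      funext z
      rw [← div_eq_mul_inv]
      rfl
    have h := (hasFDerivAt_inv' (𝕜 := ℝ) hz).comp z ((hfst.mul hc).const_add 1)
    have h2 := (Complex.reCLM.hasFDerivAt).comp z ((hfst.mul h).mul_const (conj w.2))
    rw [e]
    erw [h2.fderiv]
    change Complex.re _ = Complex.re _
    congr 1
    simp
    field_simp
    ring
  rw [coordOmega, extDeriv_apply ((contDiffAt_coordPotential hz).differentiableAt (by simp))]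
  have e0 : (0 : Fin 2).removeNth ![X, Y] = ![Y] := by
    funext i; fin_cases i; rfl
  have e1 : (1 : Fin 2).removeNth ![X, Y] = ![X] := by
    funext i; fin_cases i; rfl
  rw [Fin.sum_univ_two, e0, e1, hw, hw]
  simp only [Fin.val_zero, Fin.val_one, pow_zero, pow_one, one_smul, neg_smul, Matrix.cons_val_zero,
    Matrix.cons_val_one, ← Complex.neg_re, ← Complex.add_re]
  congr 1
  field_simp
  ring

/-! ### The contact form in null coordinates -/

/-- The pullback of `Re (dz₁ ∧ dz̄₂ / (1 + z₁ z̄₂)²)` in real coordinates: `z₁ = x1 + i y1`,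
`z₂ = x2 + i y2`, `1 + z₁ z̄₂ = u + i w`, and the primes and the suffix `s` stand for two variations.
The null vectors are `c / 2 • N(z₂)` and `d / 2 • M(z₁)`; their product is normalized by `h`, whose
derivatives along the variations are `h'` and `hs`. -/
lemma pullback_identity {c c' cs d d' ds x1 x1' x1s y1 y1' y1s x2 x2' x2s y2 y2' y2s u w Q : ℝ}
    (hu : u = 1 + x1 * x2 + y1 * y2) (hw : w = y1 * x2 - x1 * y2) (hQ : Q = u ^ 2 + w ^ 2)
    (h : c * d * Q = 4)
    (h' : (c' * d + c * d') * Q + c * d * (2 * u * (x1' * x2 + y1' * y2 + x1 * x2' + y1 * y2')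
      + 2 * w * (y1' * x2 + y1 * x2' - x1' * y2 - x1 * y2')) = 0)
    (hs : (cs * d + c * ds) * Q + c * d * (2 * u * (x1s * x2 + y1s * y2 + x1 * x2s + y1 * y2s)
      + 2 * w * (y1s * x2 + y1 * x2s - x1s * y2 - x1 * y2s)) = 0) :
    ((x1' * x2s + y1' * y2s - x1s * x2' - y1s * y2') * (u ^ 2 - w ^ 2)
      + (y1' * x2s - x1' * y2s - y1s * x2' + x1s * y2') * (2 * u * w)) / Q ^ 2 =
    1 / 4 * ((-(1 / 2) * (c' * ds + (c' * (x2 ^ 2 + y2 ^ 2) + c * (2 * x2 * x2' + 2 * y2 * y2')) *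
        (ds * (x1 ^ 2 + y1 ^ 2) + d * (2 * x1 * x1s + 2 * y1 * y1s)))
      + (c' * x2 + c * x2') * -(ds * x1 + d * x1s) + (c' * y2 + c * y2') * -(ds * y1 + d * y1s))
     - (-(1 / 2) * (cs * d' + (cs * (x2 ^ 2 + y2 ^ 2) + c * (2 * x2 * x2s + 2 * y2 * y2s)) *
        (d' * (x1 ^ 2 + y1 ^ 2) + d * (2 * x1 * x1' + 2 * y1 * y1')))
      + (cs * x2 + c * x2s) * -(d' * x1 + d * x1') + (cs * y2 + c * y2s) * -(d' * y1 + d * y1'))) := by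
  -- By the normalization, `d`, `d'` and `ds` are rational functions of the other variables.
  have hc : c ≠ 0 := by rintro rfl; simp at h
  have hQ0 : Q ≠ 0 := by rintro rfl; simp at h
  have ed : d = 4 / (c * Q) := by field_simp; linarith
  have ed' : d' = -(c' * d * Q + c * d * (2 * u * (x1' * x2 + y1' * y2 + x1 * x2' + y1 * y2')
      + 2 * w * (y1' * x2 + y1 * x2' - x1' * y2 - x1 * y2'))) / (c * Q) := by
    field_simp; linarith
  have eds : ds = -(cs * d * Q + c * d * (2 * u * (x1s * x2 + y1s * y2 + x1 * x2s + y1 * y2s)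
      + 2 * w * (y1s * x2 + y1 * x2s - x1s * y2 - x1 * y2s))) / (c * Q) := by
    field_simp; linarith
  rw [ed', eds, ed]
  field_simp
  subst hQ hu hw
  ring

lemma dTheta_apply (u : UH3) (ξ η : tangentUH3 u) :
    dTheta u ![ξ, η] = 1 / 2 * (lor η.1.1 ξ.1.2 - lor ξ.1.1 η.1.2) := by
  let L : (L4 × L4) →ₗ[ℝ] (L4 × L4) [⋀^Fin 1]→L[ℝ] ℝ :=
    { toFun := contactForm
      map_add' := fun a b => by
        ext v
        simp [contactForm, lor]; ring
      map_smul' := fun a b => by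
        ext v
        simp [contactForm, lor]; ring }
  have hd : ∀ x, DifferentiableAt ℝ contactForm x := fun x =>
    (LinearMap.toContinuousLinearMap L).differentiableAt
  have hw : ∀ w x V : L4 × L4, fderiv ℝ (fun z => contactForm z ![w]) x V = lor w.1 V.2 := by
    intro w x V
    have e : (fun z => contactForm z ![w]) = LinearMap.toContinuousLinearMap
        ({ toFun := fun z => lor w.1 z.2
           map_add' := fun a b => by simp [lor]; ring
           map_smul' := fun a b => by simp [lor]; ring } : (L4 × L4) →ₗ[ℝ] ℝ) := by
      funext z; rfl
    rw [e, ContinuousLinearMap.fderiv]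
    rfl
  have e : dTheta u ![ξ, η] = 1 / 2 * extDeriv contactForm u.1 ![ξ.1, η.1] := by
    simp only [dTheta, ContinuousAlternatingMap.compContinuousLinearMap_apply,
      ContinuousAlternatingMap.smul_apply, smul_eq_mul]
    congr 2
    funext i; fin_cases i <;> rfl
  have e0 : (0 : Fin 2).removeNth ![ξ.1, η.1] = ![η.1] := by
    funext i; fin_cases i; rfl
  have e1 : (1 : Fin 2).removeNth ![ξ.1, η.1] = ![ξ.1] := by
    funext i; fin_cases i; rfl
  rw [e, extDeriv_apply (hd _), Fin.sum_univ_two, e0, e1, hw, hw]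
  simp [sub_eq_add_neg]

/-- The null coordinate `a₀ + ε a₃` of `a`, for `ε = ±1`. -/
def light (ε : ℝ) (a : L4) : ℝ := a 0 + ε * a 3

/-- The transverse coordinate `a₁ + i ε a₂` of `a`, for `ε = ±1`. -/
def transv (ε : ℝ) (a : L4) : ℂ := ⟨a 1, ε * a 2⟩

lemma lor_eq_light {ε : ℝ} (hε : ε ^ 2 = 1) (a b : L4) :
    lor a b = -(1 / 2) * (light ε a * light (-ε) b + light (-ε) a * light ε b) +
      ((transv ε a).re * (transv ε b).re + (transv ε a).im * (transv ε b).im) := by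
  simp only [lor, light, transv]
  linear_combination (-(a 2 * b 2) - a 3 * b 3) * hε

/-- The values of `Re (dz₁ ∧ dz̄₂ / (1 + z₁ z̄₂)²)` and of `dΘ` agree on corresponding tangent vectors.
The coordinates `z` of the geodesic are given by `h1` and `h2`; the components `X`, `Y` of the images
of `ξ`, `η` are given by the derivatives of these two equations. -/
lemma coordOmega_eq_dTheta {ε : ℝ} (hε : ε ^ 2 = 1) (u : UH3) (ξ η : tangentUH3 u)
    {z X Y : ℂ × ℂ}
    (hd : light (-ε) (u.1.1 - u.1.2) ≠ 0) (hc : light ε (u.1.1 + u.1.2) ≠ 0)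
    (h1 : z.1 * light (-ε) (u.1.1 - u.1.2) = -transv ε (u.1.1 - u.1.2))
    (h2 : z.2 * light ε (u.1.1 + u.1.2) = transv ε (u.1.1 + u.1.2))
    (hX1 : X.1 * light (-ε) (u.1.1 - u.1.2) + z.1 * light (-ε) (ξ.1.1 - ξ.1.2) =
      -transv ε (ξ.1.1 - ξ.1.2))
    (hX2 : X.2 * light ε (u.1.1 + u.1.2) + z.2 * light ε (ξ.1.1 + ξ.1.2) =
      transv ε (ξ.1.1 + ξ.1.2))
    (hY1 : Y.1 * light (-ε) (u.1.1 - u.1.2) + z.1 * light (-ε) (η.1.1 - η.1.2) =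
      -transv ε (η.1.1 - η.1.2))
    (hY2 : Y.2 * light ε (u.1.1 + u.1.2) + z.2 * light ε (η.1.1 + η.1.2) =
      transv ε (η.1.1 + η.1.2)) :
    1 + z.1 * conj z.2 ≠ 0 ∧ coordOmega z ![X, Y] = dTheta u ![ξ, η] := by
  have hn := null_add u.2
  have hm := null_sub u.2
  have hnm := lor_add_sub u.2
  have hT : ∀ ζ : tangentUH3 u, lor (u.1.1 + u.1.2) (ζ.1.1 + ζ.1.2) = 0 ∧
      lor (u.1.1 - u.1.2) (ζ.1.1 - ζ.1.2) = 0 ∧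
      lor (ζ.1.1 + ζ.1.2) (u.1.1 - u.1.2) + lor (u.1.1 + u.1.2) (ζ.1.1 - ζ.1.2) = 0 := by
    rintro ⟨ζ, hζ⟩
    obtain ⟨k1, k2, k3⟩ := id hζ
    simp only [lor, Pi.add_apply, Pi.sub_apply] at k1 k2 k3 ⊢
    refine ⟨?_, ?_, ?_⟩
    · linear_combination k1 + k2 + k3
    · linear_combination k1 + k2 - k3
    · linear_combination 2 * k1 - 2 * k2
  obtain ⟨a1, a2, a3⟩ := hT ξ
  obtain ⟨b1, b2, b3⟩ := hT η
  have hth : dTheta u ![ξ, η] = 1 / 4 * (lor (ξ.1.1 + ξ.1.2) (η.1.1 - η.1.2) -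
      lor (η.1.1 + η.1.2) (ξ.1.1 - ξ.1.2)) := by
    rw [dTheta_apply]
    simp only [lor, Pi.add_apply, Pi.sub_apply]
    ring
  rw [hth]
  clear hth hT
  generalize u.1.1 + u.1.2 = n at *
  generalize u.1.1 - u.1.2 = m at *
  generalize ξ.1.1 + ξ.1.2 = n' at *
  generalize ξ.1.1 - ξ.1.2 = m' at *
  generalize η.1.1 + η.1.2 = ns at *
  generalize η.1.1 - η.1.2 = ms at *
  obtain ⟨⟨x1, y1⟩, ⟨x2, y2⟩⟩ := z
  obtain ⟨⟨x1', y1'⟩, ⟨x2', y2'⟩⟩ := X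
  obtain ⟨⟨x1s, y1s⟩, ⟨x2s, y2s⟩⟩ := Y
  have re1 : ∀ {z w t : ℂ} {r s : ℝ}, z * r + w * s = t → t.re = r * z.re + s * w.re := by
    rintro z w t r s rfl; simp; ring
  have im1 : ∀ {z w t : ℂ} {r s : ℝ}, z * r + w * s = t → t.im = r * z.im + s * w.im := by
    rintro z w t r s rfl; simp; ring
  have re0 : ∀ {z t : ℂ} {r : ℝ}, z * r = t → t.re = r * z.re := by
    rintro z t r rfl; simp; ring
  have im0 : ∀ {z t : ℂ} {r : ℝ}, z * r = t → t.im = r * z.im := by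
    rintro z t r rfl; simp; ring
  have m1 := re0 h1
  have m2 := im0 h1
  have n1 := re0 h2
  have n2 := im0 h2
  have m1' := re1 hX1
  have m2' := im1 hX1
  have n1' := re1 hX2
  have n2' := im1 hX2
  have m1s := re1 hY1
  have m2s := im1 hY1
  have n1s := re1 hY2
  have n2s := im1 hY2
  clear h1 h2 hX1 hX2 hY1 hY2 re0 re1 im0 im1
  simp only [Complex.neg_re, Complex.neg_im, neg_eq_iff_eq_neg] at m1 m2 m1' m2' m1s m2s
  simp only [lor_eq_light hε, *] at hn hm hnm a1 a2 a3 b1 b2 b3 ⊢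
  clear m1 m2 n1 n2 m1' m2' n1' n2' m1s m2s n1s n2s
  generalize light ε n = c at *
  generalize light (-ε) n = cm at *
  generalize light (-ε) m = d at *
  generalize light ε m = dp at *
  generalize light ε n' = c' at *
  generalize light (-ε) n' = cm' at *
  generalize light (-ε) m' = d' at *
  generalize light ε m' = dp' at *
  generalize light ε ns = cs at *
  generalize light (-ε) ns = cms at *
  generalize light (-ε) ms = ds at *
  generalize light ε ms = dps at *
  -- The null coordinates of `n`, `m` and of their variations are determined by the other ones.
  obtain rfl : cm = c * (x2 ^ 2 + y2 ^ 2) := mul_left_cancel₀ hc (by linear_combination -hn)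
  obtain rfl : dp = d * (x1 ^ 2 + y1 ^ 2) := mul_left_cancel₀ hd (by linear_combination -hm)
  obtain rfl : cm' = c' * (x2 ^ 2 + y2 ^ 2) + c * (2 * x2 * x2' + 2 * y2 * y2') :=
    mul_left_cancel₀ hc (by linear_combination -2 * a1)
  obtain rfl : dp' = d' * (x1 ^ 2 + y1 ^ 2) + d * (2 * x1 * x1' + 2 * y1 * y1') :=
    mul_left_cancel₀ hd (by linear_combination -2 * a2)
  obtain rfl : cms = cs * (x2 ^ 2 + y2 ^ 2) + c * (2 * x2 * x2s + 2 * y2 * y2s) :=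
    mul_left_cancel₀ hc (by linear_combination -2 * b1)
  obtain rfl : dps = ds * (x1 ^ 2 + y1 ^ 2) + d * (2 * x1 * x1s + 2 * y1 * y1s) :=
    mul_left_cancel₀ hd (by linear_combination -2 * b2)
  obtain ⟨u, hu⟩ : ∃ u, u = 1 + x1 * x2 + y1 * y2 := ⟨_, rfl⟩
  obtain ⟨w, hw⟩ : ∃ w, w = y1 * x2 - x1 * y2 := ⟨_, rfl⟩
  have hD : 1 + (⟨x1, y1⟩ : ℂ) * conj (⟨x2, y2⟩ : ℂ) = ⟨u, w⟩ := by
    apply Complex.ext <;> simp [hu, hw] <;> ring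
  have hcd : c * d * (u ^ 2 + w ^ 2) = 4 := by
    rw [hu, hw]; linear_combination -2 * hnm
  have key := pullback_identity hu hw rfl hcd (c' := c') (d' := d') (x1' := x1') (x2' := x2')
    (y1' := y1') (y2' := y2') (cs := cs) (ds := ds) (x1s := x1s) (x2s := x2s) (y1s := y1s) (y2s := y2s)
    (by rw [hu, hw]; linear_combination -2 * a3) (by rw [hu, hw]; linear_combination -2 * b3)
  have hne : 1 + (⟨x1, y1⟩ : ℂ) * conj (⟨x2, y2⟩ : ℂ) ≠ 0 := by
    rw [hD]
    intro h
    simp only [Complex.ext_iff, Complex.zero_re, Complex.zero_im] at h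
    rw [h.1, h.2] at hcd
    norm_num at hcd
  refine ⟨hne, ?_⟩
  rw [coordOmega_apply hne, hD]
  refine Eq.trans ?_ (key.trans ?_)
  · have hnorm : Complex.normSq ((⟨u, w⟩ : ℂ) ^ 2) = (u ^ 2 + w ^ 2) ^ 2 := by
      rw [map_pow, Complex.normSq_mk]; ring
    rw [Complex.div_re, hnorm, ← add_div]
    congr 1
    simp [pow_two]
    ring
  · ring

/-! ### The coordinates of a geodesic as functions on the unit tangent bundle -/

/-- Quotients of continuous linear maps are smooth, and their differential is determined by the
differentiated equation `(g / h) h = g`. -/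
lemma quotient_rule {E : Type*} [NormedAddCommGroup E] [NormedSpace ℝ E] (g : E →L[ℝ] ℂ)
    (h : E →L[ℝ] ℝ) {u : E} (hu : h u ≠ 0) :
    ContDiffAt ℝ ∞ (fun v => g v / (h v : ℂ)) u ∧ ∀ ξ,
      fderiv ℝ (fun v => g v / (h v : ℂ)) u ξ * (h u : ℂ) + g u / (h u : ℂ) * (h ξ : ℂ) = g ξ := by
  have hu' : (h u : ℂ) ≠ 0 := by exact_mod_cast hu
  have hh : ContDiffAt ℝ ∞ (fun v => (h v : ℂ)) u :=
    (Complex.ofRealCLM.contDiff.comp h.contDiff).contDiffAt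
  have hc : ContDiffAt ℝ ∞ (fun v => g v / (h v : ℂ)) u := by
    simp only [div_eq_mul_inv]
    exact g.contDiff.contDiffAt.mul (hh.inv hu')
  refine ⟨hc, fun ξ => ?_⟩
  have hd := (hc.differentiableAt (by simp)).hasFDerivAt
  have hm := hd.mul (Complex.ofRealCLM ∘L h).hasFDerivAt
  have heq : (fun v => g v / (h v : ℂ)) * (fun v => (Complex.ofRealCLM ∘L h) v) =ᶠ[𝓝 u] g := by
    filter_upwards [h.continuous.continuousAt.eventually_ne hu] with v hv
    have hv' : (h v : ℂ) ≠ 0 := by exact_mod_cast hv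
    simp [hv']
  have := congrArg (fun L : E →L[ℝ] ℂ => L ξ)
    ((hm.congr_of_eventuallyEq heq.symm).unique g.hasFDerivAt)
  simp at this
  linear_combination this

/-- The value at `(p, v)` of the coordinates of the geodesic through `p` with velocity `v`: those of
`muChart` for `ε = 1`, and those of `muInvChart` for `ε = -1`. -/
def endCoord (ε : ℝ) (u : L4 × L4) : ℂ × ℂ :=
  (-transv ε (u.1 - u.2) / (light (-ε) (u.1 - u.2) : ℂ),
    transv ε (u.1 + u.2) / (light ε (u.1 + u.2) : ℂ))

/-- The set on which both denominators of `endCoord ε` are nonzero; its intersection with `UH3` is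
the preimage under `piHat` of the domain of the corresponding chart. -/
def endDom (ε : ℝ) : Set (L4 × L4) :=
  {u | light (-ε) (u.1 - u.2) ≠ 0 ∧ light ε (u.1 + u.2) ≠ 0}

/-- `light ε` as a continuous linear form. -/
def lightCLM (ε : ℝ) : L4 →L[ℝ] ℝ :=
  LinearMap.toContinuousLinearMap
    { toFun := light ε
      map_add' := fun a b => by simp only [light, Pi.add_apply]; ring
      map_smul' := fun r a => by
        simp only [light, Pi.smul_apply, smul_eq_mul, RingHom.id_apply]; ring }

/-- `transv ε` as a continuous linear map. -/
def transvCLM (ε : ℝ) : L4 →L[ℝ] ℂ :=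
  LinearMap.toContinuousLinearMap
    { toFun := transv ε
      map_add' := fun a b => by
        apply Complex.ext <;> simp [transv]; ring
      map_smul' := fun r a => by
        apply Complex.ext <;> simp [transv]; ring }

lemma isOpen_endDom (ε : ℝ) : IsOpen (endDom ε) := by
  have h1 : Continuous fun u : L4 × L4 => light (-ε) (u.1 - u.2) :=
    (lightCLM (-ε)).continuous.comp (continuous_fst.sub continuous_snd)
  have h2 : Continuous fun u : L4 × L4 => light ε (u.1 + u.2) :=
    (lightCLM ε).continuous.comp (continuous_fst.add continuous_snd)
  exact (isOpen_ne_fun h1 continuous_const).inter (isOpen_ne_fun h2 continuous_const)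

lemma endCoord_quotient_rule {ε : ℝ} {u : L4 × L4} (hu : u ∈ endDom ε) :
    ContDiffAt ℝ ∞ (endCoord ε) u ∧ ∀ ξ,
      (fderiv ℝ (endCoord ε) u ξ).1 * light (-ε) (u.1 - u.2) +
        (endCoord ε u).1 * light (-ε) (ξ.1 - ξ.2) = -transv ε (ξ.1 - ξ.2) ∧
      (fderiv ℝ (endCoord ε) u ξ).2 * light ε (u.1 + u.2) +
        (endCoord ε u).2 * light ε (ξ.1 + ξ.2) = transv ε (ξ.1 + ξ.2) := by
  let S : (L4 × L4) →L[ℝ] L4 := ContinuousLinearMap.fst ℝ L4 L4 + ContinuousLinearMap.snd ℝ L4 L4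
  let T : (L4 × L4) →L[ℝ] L4 := ContinuousLinearMap.fst ℝ L4 L4 - ContinuousLinearMap.snd ℝ L4 L4
  obtain ⟨c1, d1⟩ := quotient_rule (-(transvCLM ε ∘L T)) (lightCLM (-ε) ∘L T) (u := u) hu.1
  obtain ⟨c2, d2⟩ := quotient_rule (transvCLM ε ∘L S) (lightCLM ε ∘L S) (u := u) hu.2
  have hc : ContDiffAt ℝ ∞ (endCoord ε) u := c1.prodMk c2
  refine ⟨hc, fun ξ => ?_⟩
  have e := (c1.differentiableAt (by simp)).fderiv_prodMk (c2.differentiableAt (by simp))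
  have e' : fderiv ℝ (endCoord ε) u = _ := e
  rw [e']
  exact ⟨d1 ξ, d2 ξ⟩

lemma contDiffAt_endCoord {ε : ℝ} {u : L4 × L4} (hu : u ∈ endDom ε) :
    ContDiffAt ℝ ∞ (endCoord ε) u := (endCoord_quotient_rule hu).1

/-- `endCoord ε` pulls `coordOmega` back to `dΘ`. -/
lemma coordOmega_endCoord {ε : ℝ} (hε : ε ^ 2 = 1) {φ : ℝ × ℝ → UH3} {s : ℝ × ℝ}
    (h : ContDiffAt ℝ ∞ (fun r => (φ r : L4 × L4)) s) (hs : (φ s : L4 × L4) ∈ endDom ε)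
    (a b : ℝ × ℝ) :
    1 + (endCoord ε (φ s)).1 * conj (endCoord ε (φ s)).2 ≠ 0 ∧
    coordOmega (endCoord ε (φ s))
      ![fderiv ℝ (fun r => endCoord ε (φ r)) s a, fderiv ℝ (fun r => endCoord ε (φ r)) s b] =
      dTheta (φ s) ![pushUH3 h a, pushUH3 h b] := by
  obtain ⟨hc, hd⟩ := endCoord_quotient_rule hs
  have e : fderiv ℝ (fun r => endCoord ε (φ r)) s =
      (fderiv ℝ (endCoord ε) (φ s)).comp (fderiv ℝ (fun r => (φ r : L4 × L4)) s) :=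
    fderiv_comp (g := endCoord ε) s (hc.differentiableAt (by simp)) (h.differentiableAt (by simp))
  rw [e]
  have h1 : (light (-ε) ((φ s).1.1 - (φ s).1.2) : ℂ) ≠ 0 := by exact_mod_cast hs.1
  have h2 : (light ε ((φ s).1.1 + (φ s).1.2) : ℂ) ≠ 0 := by exact_mod_cast hs.2
  exact coordOmega_eq_dTheta hε (φ s) (pushUH3 h a) (pushUH3 h b) hs.1 hs.2
    (div_mul_cancel₀ _ h1) (div_mul_cancel₀ _ h2) (hd _).1 (hd _).2 (hd _).1 (hd _).2

/-! ### Explicit unit tangent vectors with given endpoints -/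

/-- A null vector with `light ε = 2` and `transv ε = 2 z`. -/
def nullSec (ε : ℝ) (z : ℂ) : L4 :=
  ![1 + Complex.normSq z, 2 * z.re, 2 * ε * z.im, ε * (1 - Complex.normSq z)]

/-- A point of `UH3` at which `endCoord ε` takes the value `z`, for `1 + z₁ z̄₂ ≠ 0`. Of the points
of the geodesic it is the one with `p + v = nullSec ε z₂`; this choice makes `sect ε` rational. -/
def sect (ε : ℝ) (z : ℂ × ℂ) : L4 × L4 :=
  ((1 / 2 : ℝ) • (nullSec ε z.2 +
      (Complex.normSq (1 + z.1 * conj z.2))⁻¹ • nullSec (-ε) (-conj z.1)),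
    (1 / 2 : ℝ) • (nullSec ε z.2 -
      (Complex.normSq (1 + z.1 * conj z.2))⁻¹ • nullSec (-ε) (-conj z.1)))

lemma sect_add (ε : ℝ) (z : ℂ × ℂ) : (sect ε z).1 + (sect ε z).2 = nullSec ε z.2 := by
  simp only [sect]; module

lemma sect_sub (ε : ℝ) (z : ℂ × ℂ) : (sect ε z).1 - (sect ε z).2 =
    (Complex.normSq (1 + z.1 * conj z.2))⁻¹ • nullSec (-ε) (-conj z.1) := by
  simp only [sect]; module

lemma light_nullSec {ε : ℝ} (hε : ε ^ 2 = 1) (z : ℂ) : light ε (nullSec ε z) = 2 := by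
  simp [light, nullSec]
  linear_combination (1 - Complex.normSq z) * hε

lemma transv_nullSec {ε : ℝ} (hε : ε ^ 2 = 1) (z : ℂ) : transv ε (nullSec ε z) = 2 * z := by
  apply Complex.ext
  · simp [transv, nullSec]
  · simp [transv, nullSec]
    linear_combination 2 * z.im * hε

lemma transv_neg_nullSec {ε : ℝ} (hε : ε ^ 2 = 1) (z : ℂ) :
    transv ε (nullSec (-ε) (-conj z)) = -(2 * z) := by
  apply Complex.ext
  · simp [transv, nullSec]
  · simp [transv, nullSec]
    linear_combination 2 * z.im * hε

lemma lor_nullSec {ε : ℝ} (hε : ε ^ 2 = 1) (z : ℂ) : lor (nullSec ε z) (nullSec ε z) = 0 := by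
  simp [lor, nullSec, Complex.normSq_apply]
  linear_combination ((1 - (z.re * z.re + z.im * z.im)) ^ 2 + 4 * z.im ^ 2) * hε

lemma lor_nullSec_nullSec {ε : ℝ} (hε : ε ^ 2 = 1) (z w : ℂ) :
    lor (nullSec ε w) (nullSec (-ε) (-conj z)) = -2 * Complex.normSq (1 + z * conj w) := by
  simp [lor, nullSec, Complex.normSq_apply]
  linear_combination -((1 - (z.re * z.re + z.im * z.im)) * (1 - (w.re * w.re + w.im * w.im)) +
    4 * z.im * w.im) * hε

lemma sect_mem_UH3 {ε : ℝ} (hε : ε ^ 2 = 1) {z : ℂ × ℂ} (hz : 1 + z.1 * conj z.2 ≠ 0) :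
    sect ε z ∈ UH3 := by
  have hQ := Complex.normSq_pos.2 hz
  have h1 := lor_nullSec hε z.2
  have h2 := lor_nullSec (by simpa using hε : (-ε) ^ 2 = 1) (-conj z.1)
  have h3 := lor_nullSec_nullSec hε z.1 z.2
  have p1 : 0 < nullSec ε z.2 0 := by
    have := Complex.normSq_nonneg z.2
    simp [nullSec]; linarith
  have p2 : 0 < nullSec (-ε) (-conj z.1) 0 := by
    have := Complex.normSq_nonneg z.1
    simp [nullSec]; linarith
  simp only [sect, UH3, H3, Set.mem_ofPred_eq]
  generalize nullSec ε z.2 = n at *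
  generalize nullSec (-ε) (-conj z.1) = m at *
  generalize Complex.normSq (1 + z.1 * conj z.2) = Q at *
  have hi : Q⁻¹ * Q = 1 := inv_mul_cancel₀ hQ.ne'
  have hip : 0 < Q⁻¹ := inv_pos.2 hQ
  generalize Q⁻¹ = q at *
  simp only [lor, Pi.add_apply, Pi.sub_apply, Pi.smul_apply, smul_eq_mul] at *
  refine ⟨⟨?_, by positivity⟩, ?_, ?_⟩
  · linear_combination h1 / 4 + q ^ 2 / 4 * h2 + q / 2 * h3 - hi
  · linear_combination h1 / 4 + q ^ 2 / 4 * h2 - q / 2 * h3 + hi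
  · linear_combination h1 / 4 - q ^ 2 / 4 * h2

lemma endCoord_sect {ε : ℝ} (hε : ε ^ 2 = 1) {z : ℂ × ℂ} (hz : 1 + z.1 * conj z.2 ≠ 0) :
    sect ε z ∈ endDom ε ∧ endCoord ε (sect ε z) = z := by
  have hQ := (Complex.normSq_pos.2 hz).ne'
  have h1 : light ε ((sect ε z).1 + (sect ε z).2) = 2 := by rw [sect_add, light_nullSec hε]
  have h2 : light (-ε) ((sect ε z).1 - (sect ε z).2) =
      (Complex.normSq (1 + z.1 * conj z.2))⁻¹ * 2 := by
    rw [sect_sub, ← light_nullSec (by simpa using hε : (-ε) ^ 2 = 1) (-conj z.1)]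
    exact (lightCLM (-ε)).map_smul _ _
  have h3 : transv ε ((sect ε z).1 - (sect ε z).2) =
      ((Complex.normSq (1 + z.1 * conj z.2))⁻¹ : ℝ) * -(2 * z.1) := by
    rw [sect_sub, ← transv_neg_nullSec hε]
    exact (transvCLM ε).map_smul _ _
  refine ⟨⟨?_, ?_⟩, ?_⟩
  · rw [h2]
    exact mul_ne_zero (inv_ne_zero hQ) two_ne_zero
  · rw [h1]; exact two_ne_zero
  · rw [endCoord, h1, h2, h3, sect_add, transv_nullSec hε]
    have hQ' : (Complex.normSq (1 + z.1 * conj z.2) : ℂ) ≠ 0 := by exact_mod_cast hQ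
    refine Prod.ext ?_ ?_
    · simp only [Complex.ofReal_mul, Complex.ofReal_inv]
      generalize (Complex.normSq (1 + z.1 * conj z.2) : ℂ) = q at *
      push_cast
      field_simp
    · push_cast
      field_simp

lemma contDiff_normSq : ContDiff ℝ ∞ (Complex.normSq : ℂ → ℝ) := by
  have : (Complex.normSq : ℂ → ℝ) = fun z => Complex.reCLM z * Complex.reCLM z +
    Complex.imCLM z * Complex.imCLM z := by
    funext z; simp [Complex.normSq_apply]
  rw [this]
  exact (Complex.reCLM.contDiff.mul Complex.reCLM.contDiff).add
    (Complex.imCLM.contDiff.mul Complex.imCLM.contDiff)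

lemma contDiff_nullSec (ε : ℝ) : ContDiff ℝ ∞ (nullSec ε) := by
  have hre : ContDiff ℝ ∞ (fun z : ℂ => z.re) := Complex.reCLM.contDiff
  have him : ContDiff ℝ ∞ (fun z : ℂ => z.im) := Complex.imCLM.contDiff
  rw [contDiff_pi]
  intro i
  fin_cases i
  · exact contDiff_const.add contDiff_normSq
  · exact contDiff_const.mul hre
  · exact contDiff_const.mul him
  · exact contDiff_const.mul (contDiff_const.sub contDiff_normSq)

lemma contDiffAt_sect (ε : ℝ) {z : ℂ × ℂ} (hz : 1 + z.1 * conj z.2 ≠ 0) :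
    ContDiffAt ℝ ∞ (sect ε) z := by
  have hc1 : ContDiff ℝ ∞ (fun z : ℂ × ℂ => conj z.1) :=
    Complex.conjCLE.contDiff.comp contDiff_fst
  have hc2 : ContDiff ℝ ∞ (fun z : ℂ × ℂ => conj z.2) :=
    Complex.conjCLE.contDiff.comp contDiff_snd
  have hq : ContDiffAt ℝ ∞ (fun z : ℂ × ℂ => (Complex.normSq (1 + z.1 * conj z.2))⁻¹) z :=
    (contDiff_normSq.comp (contDiff_const.add (contDiff_fst.mul hc2))).contDiffAt.inv
      (Complex.normSq_pos.2 hz).ne'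
  have hn : ContDiffAt ℝ ∞ (fun z : ℂ × ℂ => nullSec ε z.2) z :=
    ((contDiff_nullSec ε).comp contDiff_snd).contDiffAt
  have hm : ContDiffAt ℝ ∞ (fun z : ℂ × ℂ => nullSec (-ε) (-conj z.1)) z :=
    ((contDiff_nullSec (-ε)).comp hc1.neg).contDiffAt
  exact ((hn.add (hq.smul hm)).const_smul (1 / 2 : ℝ)).prodMk
    ((hn.sub (hq.smul hm)).const_smul (1 / 2 : ℝ))

/-! ### The charts in terms of unit tangent vectors -/

lemma nullPt_of_light {n : L4} (h : light (-1) n ≠ 0) :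
    nullPt n = ((transv 1 n / light (-1) n : ℂ) : OnePoint ℂ) := by
  have h' : n 0 - n 3 ≠ 0 := by simpa [light, sub_eq_add_neg] using h
  rw [nullPt, if_neg h']
  congr 2
  · apply Complex.ext <;> simp [transv]
  · simp [light, sub_eq_add_neg]

lemma nullPt_eq_infty {n : L4} (h : light (-1) n = 0) : nullPt n = OnePoint.infty := by
  have h' : n 0 - n 3 = 0 := by simpa [light, sub_eq_add_neg] using h
  rw [nullPt, if_pos h']

lemma nullPt_ne_infty_iff {n : L4} : nullPt n ≠ OnePoint.infty ↔ light (-1) n ≠ 0 := by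
  constructor
  · exact fun h h' => h (nullPt_eq_infty h')
  · intro h
    rw [nullPt_of_light h]
    exact OnePoint.coe_ne_infty _

lemma light_mul_light {n : L4} (hn : lor n n = 0) :
    (light 1 n : ℂ) * light (-1) n = transv 1 n * transv (-1) n := by
  have : n 0 ^ 2 - n 3 ^ 2 = n 1 ^ 2 + n 2 ^ 2 := by
    simp only [lor] at hn; linear_combination -hn
  apply Complex.ext
  · simp [light, transv]; linear_combination this
  · simp [light, transv]; ring

lemma light_pos {n : L4} (h0 : 0 < n 0) (h : light (-1) n = 0) : light 1 n ≠ 0 := by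
  simp only [light] at *
  intro h'
  linarith

lemma transv_neg_one (n : L4) : transv (-1) n = conj (transv 1 n) := by
  apply Complex.ext <;> simp [transv]

lemma transv_ne_zero {n : L4} (hn : lor n n = 0) (h1 : light 1 n ≠ 0) (h : light (-1) n ≠ 0) :
    transv 1 n ≠ 0 := by
  have := light_mul_light hn
  intro h'
  rw [h', zero_mul] at this
  exact mul_ne_zero (Complex.ofReal_ne_zero.2 h1) (Complex.ofReal_ne_zero.2 h) this

lemma nullPt_ne_zero_iff {n : L4} (hn : lor n n = 0) (h0 : 0 < n 0) :
    nullPt n ≠ ((0 : ℂ) : OnePoint ℂ) ↔ light 1 n ≠ 0 := by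
  by_cases h : light (-1) n = 0
  · rw [nullPt_eq_infty h]
    exact iff_of_true (OnePoint.infty_ne_coe _) (light_pos h0 h)
  · rw [nullPt_of_light h]
    have hc : (light (-1) n : ℂ) ≠ 0 := by exact_mod_cast h
    rw [Ne, OnePoint.coe_eq_coe, div_eq_zero_iff, or_iff_left hc]
    refine ⟨fun h1 h2 => h1 ?_, fun h1 => transv_ne_zero hn h1 h⟩
    have h3 := light_mul_light hn
    rw [h2, transv_neg_one, Complex.ofReal_zero, zero_mul, Complex.mul_conj] at h3
    exact Complex.normSq_eq_zero.1 (by exact_mod_cast h3.symm)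

/-- The reciprocal of the point of `ℂ ∪ {∞}` given by a null vector, with `1 / ∞ = 0`: it is regular
also at `∞`. The function `f` stands for the conjugation or the negation in the definitions of the
charts. -/
lemma elim_inv_nullPt {n : L4} (hn : lor n n = 0) (h1 : light 1 n ≠ 0) (f : ℂ → ℂ) (hf : f 0 = 0) :
    (nullPt n).elim 0 (fun z => f z⁻¹) = f (transv (-1) n / light 1 n) := by
  by_cases h : light (-1) n = 0
  · rw [nullPt_eq_infty h, OnePoint.elim_infty]
    have h3 := light_mul_light hn
    rw [h, transv_neg_one, Complex.ofReal_zero, mul_zero, Complex.mul_conj] at h3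
    have h4 : transv 1 n = 0 := Complex.normSq_eq_zero.1 (by exact_mod_cast h3.symm)
    rw [transv_neg_one, h4, map_zero, zero_div, hf]
  · rw [nullPt_of_light h, OnePoint.elim_some]
    have h3 := light_mul_light hn
    have hc : (light (-1) n : ℂ) ≠ 0 := by exact_mod_cast h
    have hc1 : (light 1 n : ℂ) ≠ 0 := by exact_mod_cast h1
    have ht := transv_ne_zero hn h1 h
    congr 1
    field_simp
    linear_combination h3

lemma add_pos_UH3 (u : UH3) : 0 < (u.1.1 + u.1.2) 0 := by
  have := abs_lt.1 (fut (p := u.1.1) (v := u.1.2) u.2)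
  simp only [Pi.add_apply]; linarith

lemma sub_pos_UH3 (u : UH3) : 0 < (u.1.1 - u.1.2) 0 := by
  have := abs_lt.1 (fut (p := u.1.1) (v := u.1.2) u.2)
  simp only [Pi.sub_apply]; linarith

lemma piHat_mem_muChart (u : UH3) : piHat u ∈ muChart.source ↔ u.1 ∈ endDom 1 := by
  change endPlus _ ≠ _ ∧ endMinus _ ≠ _ ↔ _ ∧ _
  rw [endPlus_piHat, endMinus_piHat, nullPt_ne_zero_iff (null_add u.2) (add_pos_UH3 u),
    nullPt_ne_infty_iff, and_comm]

lemma muChart_piHat (u : UH3) (hu : u.1 ∈ endDom 1) : muChart (piHat u) = endCoord 1 u.1 := by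
  change ((endMinus _).elim 0 _, (endPlus _).elim 0 _) = _
  rw [endPlus_piHat, endMinus_piHat]
  refine Prod.ext ?_ ?_
  · simp only [nullPt_of_light hu.1, OnePoint.elim_some, endCoord, neg_div]
  · have h := elim_inv_nullPt (null_add u.2) hu.2 (fun z => conj z) (map_zero _)
    simp only [map_inv₀] at h
    simp only [h, endCoord, transv_neg_one, map_div₀, Complex.conj_conj, Complex.conj_ofReal]

lemma piHat_mem_muInvChart (u : UH3) : piHat u ∈ muInvChart.source ↔ u.1 ∈ endDom (-1) := by
  change endPlus _ ≠ _ ∧ endMinus _ ≠ _ ↔ light (- -1) _ ≠ 0 ∧ _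
  rw [endPlus_piHat, endMinus_piHat, nullPt_ne_zero_iff (null_sub u.2) (sub_pos_UH3 u),
    nullPt_ne_infty_iff, neg_neg, and_comm]

lemma muInvChart_piHat (u : UH3) (hu : u.1 ∈ endDom (-1)) :
    muInvChart (piHat u) = endCoord (-1) u.1 := by
  change ((endMinus _).elim 0 _, (endPlus _).elim 0 _) = _
  obtain ⟨h1, h2⟩ := hu
  rw [neg_neg] at h1
  rw [endPlus_piHat, endMinus_piHat]
  refine Prod.ext ?_ ?_
  · have h := elim_inv_nullPt (null_sub u.2) h1 (fun z => -z) neg_zero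
    simp only [h, endCoord, neg_neg, neg_div]
  · simp only [nullPt_of_light h2, OnePoint.elim_some, endCoord, transv_neg_one, map_div₀,
      Complex.conj_ofReal]

/-- Every chart of the atlas is given on unit tangent vectors by `endCoord ε` for a sign `ε`. -/
lemma exists_sign {e : OpenPartialHomeomorph LH3 (ℂ × ℂ)} (he : e ∈ atlas (ℂ × ℂ) LH3) :
    ∃ ε : ℝ, ε ^ 2 = 1 ∧ (∀ u : UH3, piHat u ∈ e.source ↔ u.1 ∈ endDom ε) ∧
      (∀ u : UH3, u.1 ∈ endDom ε → e (piHat u) = endCoord ε u.1) ∧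
      e.target = {z : ℂ × ℂ | 1 + z.1 * conj z.2 ≠ 0} := by
  obtain ⟨f, hf, rfl⟩ : ∃ f, ∃ hf : f ∈ lh3Core.atlas, lh3Core.openPartialHomeomorph f hf = e := by
    obtain ⟨f, hf, h⟩ := Set.mem_iUnion₂.1 he
    exact ⟨f, hf, h.symm⟩
  rcases id hf with rfl | rfl
  · exact ⟨1, by norm_num, piHat_mem_muChart, muChart_piHat, rfl⟩
  · exact ⟨-1, by norm_num, piHat_mem_muInvChart, muInvChart_piHat, rfl⟩

lemma symm_eq_piHat_sect {e : OpenPartialHomeomorph LH3 (ℂ × ℂ)} {ε : ℝ} (hε : ε ^ 2 = 1)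
    (h1 : ∀ u : UH3, piHat u ∈ e.source ↔ u.1 ∈ endDom ε)
    (h2 : ∀ u : UH3, u.1 ∈ endDom ε → e (piHat u) = endCoord ε u.1) {z : ℂ × ℂ}
    (hz : 1 + z.1 * conj z.2 ≠ 0) : e.symm z = piHat ⟨sect ε z, sect_mem_UH3 hε hz⟩ := by
  obtain ⟨k1, k2⟩ := endCoord_sect hε hz
  rw [← e.left_inv ((h1 ⟨sect ε z, sect_mem_UH3 hε hz⟩).2 k1), h2 _ k1]
  exact congrArg _ k2.symm

open Classical in
/-- The lift `r ↦ sect ε (z + r₁ X + r₂ Y)` to `UH3` of an affine plane in coordinates (junk where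
`sect ε` is not in `UH3`). -/
def sectPlane (ε : ℝ) (z X Y : ℂ × ℂ) (r : ℝ × ℝ) : UH3 :=
  if h : sect ε (z + (r.1 • X + r.2 • Y)) ∈ UH3 then ⟨_, h⟩ else
    ⟨sect 1 (0, 0), sect_mem_UH3 (by norm_num) (by simp)⟩

/-- The linear part `r ↦ r₁ X + r₂ Y` of an affine plane. -/
def planeCLM (X Y : ℂ × ℂ) : ℝ × ℝ →L[ℝ] ℂ × ℂ :=
  (ContinuousLinearMap.fst ℝ ℝ ℝ).smulRight X + (ContinuousLinearMap.snd ℝ ℝ ℝ).smulRight Y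

lemma hasFDerivAt_plane (z X Y : ℂ × ℂ) :
    HasFDerivAt (fun r : ℝ × ℝ => z + (r.1 • X + r.2 • Y)) (planeCLM X Y) 0 :=
  (planeCLM X Y).hasFDerivAt.const_add z

lemma eventually_plane {z : ℂ × ℂ} (X Y : ℂ × ℂ) {p : ℂ × ℂ → Prop} (h : ∀ᶠ w in 𝓝 z, p w) :
    ∀ᶠ r : ℝ × ℝ in 𝓝 0, p (z + (r.1 • X + r.2 • Y)) := by
  have hc := (hasFDerivAt_plane z X Y).continuousAt
  refine hc.eventually ?_
  simpa using h

lemma eventually_target {z : ℂ × ℂ} (hz : 1 + z.1 * conj z.2 ≠ 0) :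
    ∀ᶠ w : ℂ × ℂ in 𝓝 z, 1 + w.1 * conj w.2 ≠ 0 := isOpen_target.mem_nhds hz

lemma sectPlane_eq {ε : ℝ} (hε : ε ^ 2 = 1) {z X Y : ℂ × ℂ} {r : ℝ × ℝ}
    (h : 1 + (z + (r.1 • X + r.2 • Y)).1 * conj (z + (r.1 • X + r.2 • Y)).2 ≠ 0) :
    sectPlane ε z X Y r = ⟨sect ε (z + (r.1 • X + r.2 • Y)), sect_mem_UH3 hε h⟩ :=
  dif_pos (sect_mem_UH3 hε h)

lemma contDiffAt_sectPlane {ε : ℝ} (hε : ε ^ 2 = 1) {z : ℂ × ℂ} (hz : 1 + z.1 * conj z.2 ≠ 0)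
    (X Y : ℂ × ℂ) : ContDiffAt ℝ ∞ (fun r => (sectPlane ε z X Y r : L4 × L4)) 0 := by
  have h1 : ContDiffAt ℝ ∞ (fun r : ℝ × ℝ => z + (r.1 • X + r.2 • Y)) 0 :=
    contDiffAt_const.add (planeCLM X Y).contDiff.contDiffAt
  have h2 : ContDiffAt ℝ ∞ (fun r : ℝ × ℝ => sect ε (z + (r.1 • X + r.2 • Y))) 0 :=
    ContDiffAt.comp (g := sect ε) 0 (contDiffAt_sect ε (by simpa using hz)) h1
  refine h2.congr_of_eventuallyEq ?_
  filter_upwards [eventually_plane X Y (eventually_target hz)] with r hr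
  rw [sectPlane_eq hε hr]

/-- The pullback of `coordOmega` by a map `T` which agrees near `z` with `endCoord ε' ∘ sect ε` is the
pullback of `dΘ` by `sect ε`, and hence does not depend on `ε'`. -/
lemma coordOmega_fderiv {ε ε' : ℝ} (hε : ε ^ 2 = 1) (hε' : ε' ^ 2 = 1) {z : ℂ × ℂ}
    (hz : 1 + z.1 * conj z.2 ≠ 0) (hs : sect ε z ∈ endDom ε') {T : ℂ × ℂ → ℂ × ℂ}
    (hT : T =ᶠ[𝓝 z] fun w => endCoord ε' (sect ε w)) (X Y : ℂ × ℂ) :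
    coordOmega (T z) ![fderiv ℝ T z X, fderiv ℝ T z Y] =
      dTheta (sectPlane ε z X Y 0)
        ![pushUH3 (contDiffAt_sectPlane hε hz X Y) (1, 0),
          pushUH3 (contDiffAt_sectPlane hε hz X Y) (0, 1)] := by
  have h0 : (sectPlane ε z X Y 0 : L4 × L4) = sect ε z := by
    rw [sectPlane_eq hε (by simpa using hz)]; simp
  have hev : (fun r => endCoord ε' (sectPlane ε z X Y r)) =ᶠ[𝓝 0]
      fun r : ℝ × ℝ => T (z + (r.1 • X + r.2 • Y)) := by
    filter_upwards [eventually_plane X Y (eventually_target hz), eventually_plane X Y hT]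
      with r hr hr'
    rw [sectPlane_eq hε hr, hr']
  have hTd : DifferentiableAt ℝ T z :=
    ((((contDiffAt_endCoord hs).comp z (contDiffAt_sect ε hz)).differentiableAt
      (by simp)).congr_of_eventuallyEq hT)
  have hd : fderiv ℝ (fun r => endCoord ε' (sectPlane ε z X Y r)) 0 =
      (fderiv ℝ T z).comp (planeCLM X Y) := by
    rw [hev.fderiv_eq]
    have h := hasFDerivAt_plane z X Y
    have hTd' : HasFDerivAt T (fderiv ℝ T z) (z + ((0 : ℝ × ℝ).1 • X + (0 : ℝ × ℝ).2 • Y)) := by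
      simpa using hTd.hasFDerivAt
    exact (HasFDerivAt.comp (0 : ℝ × ℝ) hTd' h).fderiv
  have key := (coordOmega_endCoord hε' (contDiffAt_sectPlane hε hz X Y) (by rw [h0]; exact hs)
    (1, 0) (0, 1)).2
  rw [← key, hd, h0, hT.self_of_nhds]
  simp [planeCLM]

/-! ### Two-forms in charts -/

instance : IsManifold 𝓘(ℝ, ℂ × ℂ) 1 LH3 := IsManifold.of_le (n := ∞) (by simp)

lemma mfderiv_atlas_symm {e : OpenPartialHomeomorph LH3 (ℂ × ℂ)} (he : e ∈ atlas (ℂ × ℂ) LH3)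
    {z : ℂ × ℂ} (hz : z ∈ e.target) :
    mfderiv 𝓘(ℝ, ℂ × ℂ) 𝓘(ℝ, ℂ × ℂ) e.symm z =
      fderiv ℝ (fun w => chartAt (ℂ × ℂ) (e.symm z) (e.symm w)) z := by
  refine (mdifferentiableAt_atlas_symm (I := 𝓘(ℝ, ℂ × ℂ)) he hz).mfderiv.trans ?_
  simp only [writtenInExtChartAt, modelWithCornersSelf_coe, Set.range_id, fderivWithin_univ,
    extChartAt, mfld_simps]
  rfl

/-- Testing a `2`-form on the image of the differential of a map `f` into `LH3` amounts to testing its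
expression in a chart on the image of the differential of the coordinate expression `g` of `f`. -/
lemma apply_mfderiv {om : TwoForm} {e : OpenPartialHomeomorph LH3 (ℂ × ℂ)}
    (he : e ∈ atlas (ℂ × ℂ) LH3) {f : ℝ × ℝ → LH3} {g : ℝ × ℝ → ℂ × ℂ} {s : ℝ × ℝ}
    (hfg : f =ᶠ[𝓝 s] fun r => e.symm (g r)) (hg : DifferentiableAt ℝ g s)
    (hs : g s ∈ e.target) (a b : ℝ × ℝ) :
    om (f s) ![mfderiv 𝓘(ℝ, ℝ × ℝ) 𝓘(ℝ, ℂ × ℂ) f s a, mfderiv 𝓘(ℝ, ℝ × ℝ) 𝓘(ℝ, ℂ × ℂ) f s b] =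
      chartExpr om e (g s) ![fderiv ℝ g s a, fderiv ℝ g s b] := by
  have h := mfderiv_comp s (mdifferentiableAt_atlas_symm (I := 𝓘(ℝ, ℂ × ℂ)) he hs)
    hg.mdifferentiableAt
  rw [mfderiv_eq_fderiv] at h
  let om' : LH3 → (ℂ × ℂ) [⋀^Fin 2]→L[ℝ] ℝ := om
  have hf : mfderiv 𝓘(ℝ, ℝ × ℝ) 𝓘(ℝ, ℂ × ℂ) f s = _ := hfg.mfderiv_eq.trans h
  have e1 : f s = e.symm (g s) := hfg.self_of_nhds
  change om' (f s) ![_, _] = om' (e.symm (g s)) (_ ∘ _)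
  rw [e1]
  congr 1
  funext i
  fin_cases i
  · exact congrArg (fun L : ℝ × ℝ →L[ℝ] ℂ × ℂ => L a) hf
  · exact congrArg (fun L : ℝ × ℝ →L[ℝ] ℂ × ℂ => L b) hf

/-- In the preferred chart at `x` the expression of a `2`-form at `x` is the form itself, tangent
vectors at `x` being given by their components in this chart. -/
lemma chartExpr_chartAt (om : TwoForm) (x : LH3) (X Y : ℂ × ℂ) :
    chartExpr om (chartAt (ℂ × ℂ) x) (chartAt (ℂ × ℂ) x x) ![X, Y] = om x ![X, Y] := by
  have hx := mem_chart_source (ℂ × ℂ) x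
  have hz := (chartAt (ℂ × ℂ) x).map_source hx
  have hl := (chartAt (ℂ × ℂ) x).left_inv hx
  have h := mfderiv_atlas_symm (chart_mem_atlas (ℂ × ℂ) x) hz
  have h2 : fderiv ℝ (fun w => chartAt (ℂ × ℂ) x ((chartAt (ℂ × ℂ) x).symm w))
      (chartAt (ℂ × ℂ) x x) = ContinuousLinearMap.id ℝ (ℂ × ℂ) := by
    have : (fun w => chartAt (ℂ × ℂ) x ((chartAt (ℂ × ℂ) x).symm w)) =ᶠ[𝓝 (chartAt (ℂ × ℂ) x x)]
        id := by
      filter_upwards [(chartAt (ℂ × ℂ) x).open_target.mem_nhds hz] with w hw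
      exact (chartAt (ℂ × ℂ) x).right_inv hw
    rw [this.fderiv_eq, fderiv_id]
  rw [hl, h2] at h
  let om' : LH3 → (ℂ × ℂ) [⋀^Fin 2]→L[ℝ] ℝ := om
  change om' _ (_ ∘ _) = om' x _
  rw [hl]
  congr 1
  funext i
  fin_cases i
  · exact congrArg (fun L : ℂ × ℂ →L[ℝ] ℂ × ℂ => L X) h
  · exact congrArg (fun L : ℂ × ℂ →L[ℝ] ℂ × ℂ => L Y) h

lemma alternating_ext {f g : (ℂ × ℂ) [⋀^Fin 2]→L[ℝ] ℝ} (h : ∀ X Y, f ![X, Y] = g ![X, Y]) :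
    f = g := by
  ext v
  have : v = ![v 0, v 1] := by funext i; fin_cases i <;> rfl
  rw [this]
  exact h _ _

/-- The canonical symplectic form of `LH3`, given by `coordOmega` in the coordinates. -/
def canonicalForm : TwoForm := fun x => coordOmega (chartAt (ℂ × ℂ) x x)

/-- The form `canonicalForm` has the same expression in both coordinate systems: both expressions
are pullbacks of `dΘ` by a local section of `piHat`. -/
lemma chartExpr_canonicalForm {e : OpenPartialHomeomorph LH3 (ℂ × ℂ)}
    (he : e ∈ atlas (ℂ × ℂ) LH3) {z : ℂ × ℂ} (hz : z ∈ e.target) :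
    chartExpr canonicalForm e z = coordOmega z := by
  apply alternating_ext
  intro X Y
  have h := mfderiv_atlas_symm he hz
  have hch := chart_mem_atlas (ℂ × ℂ) (e.symm z)
  have hsrc := mem_chart_source (ℂ × ℂ) (e.symm z)
  -- The left side is the pullback of `coordOmega` by the change of coordinates to the preferred chart.
  have hR : chartExpr canonicalForm e z ![X, Y] =
      coordOmega (chartAt (ℂ × ℂ) (e.symm z) (e.symm z))
        ![fderiv ℝ (fun w => chartAt (ℂ × ℂ) (e.symm z) (e.symm w)) z X,
          fderiv ℝ (fun w => chartAt (ℂ × ℂ) (e.symm z) (e.symm w)) z Y] := by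
    change coordOmega _ (_ ∘ _) = _
    congr 1
    funext i
    fin_cases i
    · exact congrArg (fun L : ℂ × ℂ →L[ℝ] ℂ × ℂ => L X) h
    · exact congrArg (fun L : ℂ × ℂ →L[ℝ] ℂ × ℂ => L Y) h
  rw [hR]
  generalize chartAt (ℂ × ℂ) (e.symm z) = c at *
  obtain ⟨ε, hε, h1, h2, ht⟩ := exists_sign he
  obtain ⟨ε', hε', h1', h2', ht'⟩ := exists_sign hch
  rw [ht] at hz
  obtain ⟨k1, k2⟩ := endCoord_sect hε hz
  rw [symm_eq_piHat_sect hε h1 h2 hz] at hsrc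
  have hs : sect ε z ∈ endDom ε' := (h1' _).1 hsrc
  have hT : (fun w => c (e.symm w)) =ᶠ[𝓝 z] fun w => endCoord ε' (sect ε w) := by
    filter_upwards [eventually_target hz, (contDiffAt_sect ε hz).continuousAt.eventually
      ((isOpen_endDom ε').mem_nhds hs)] with w hw hw'
    rw [symm_eq_piHat_sect hε h1 h2 hw]
    exact h2' _ hw'
  have hI : (id : ℂ × ℂ → ℂ × ℂ) =ᶠ[𝓝 z] fun w => endCoord ε (sect ε w) := by
    filter_upwards [eventually_target hz] with w hw
    exact (endCoord_sect hε hw).2.symm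
  have r1 := coordOmega_fderiv hε hε' hz hs hT X Y
  have r2 := coordOmega_fderiv hε hε hz k1 hI X Y
  rw [fderiv_id] at r2
  exact r1.trans r2.symm

lemma coordOmega_nondegenerate {z : ℂ × ℂ} (hz : 1 + z.1 * conj z.2 ≠ 0) {X : ℂ × ℂ}
    (h : ∀ Y, coordOmega z ![X, Y] = 0) : X = 0 := by
  have hz2 : (1 + z.1 * conj z.2) ^ 2 ≠ 0 := pow_ne_zero 2 hz
  -- For these two `Y` the value is `± |X₁|² / |D|⁴`, resp. `± |X₂|² / |D|⁴`, with `D = 1 + z₁ z̄₂`.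
  have h1 := h (0, X.1 / (1 + z.1 * conj z.2) ^ 2)
  have h2 := h (conj (conj X.2 / (1 + z.1 * conj z.2) ^ 2), 0)
  rw [coordOmega_apply hz] at h1 h2
  refine Prod.ext ?_ ?_
  · rw [zero_mul, sub_zero, mul_div_right_comm, Complex.mul_conj, Complex.ofReal_re,
      Complex.normSq_eq_zero, div_eq_zero_iff, or_iff_left hz2] at h1
    exact h1
  · rw [map_zero, mul_zero, zero_sub, neg_div, mul_div_assoc, mul_comm, Complex.mul_conj,
      Complex.neg_re, Complex.ofReal_re, neg_eq_zero, Complex.normSq_eq_zero, div_eq_zero_iff,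
      or_iff_left hz2] at h2
    simpa using h2

lemma one_add_ne_zero {e : OpenPartialHomeomorph LH3 (ℂ × ℂ)} (he : e ∈ atlas (ℂ × ℂ) LH3)
    {z : ℂ × ℂ} (hz : z ∈ e.target) : 1 + z.1 * conj z.2 ≠ 0 := by
  obtain ⟨ε, -, -, -, ht⟩ := exists_sign he
  rwa [ht] at hz

lemma chartAt_ne_zero (x : LH3) :
    1 + (chartAt (ℂ × ℂ) x x).1 * conj (chartAt (ℂ × ℂ) x x).2 ≠ 0 :=
  one_add_ne_zero (chart_mem_atlas (ℂ × ℂ) x)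
    ((chartAt (ℂ × ℂ) x).map_source (mem_chart_source (ℂ × ℂ) x))

lemma isSymplectic_canonicalForm : IsSymplectic canonicalForm where
  smooth e he := ContDiffOn.congr
    (fun z hz => (contDiffAt_coordOmega (one_add_ne_zero he hz)).contDiffWithinAt)
    (fun z hz => chartExpr_canonicalForm he hz)
  closed e he z hz := by
    have : chartExpr canonicalForm e =ᶠ[𝓝 z] coordOmega := by
      filter_upwards [e.open_target.mem_nhds hz] with w hw
      exact chartExpr_canonicalForm he hw
    rw [this.extDeriv_eq]
    exact extDeriv_coordOmega (one_add_ne_zero he hz)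
  nondegenerate x X h := coordOmega_nondegenerate (chartAt_ne_zero x) h

/-- The pullback to `UH3` of a `2`-form, in terms of its expression in a chart; that of `coordOmega`
is `dΘ`. -/
lemma pullback_chart {e : OpenPartialHomeomorph LH3 (ℂ × ℂ)} (he : e ∈ atlas (ℂ × ℂ) LH3)
    {φ : ℝ × ℝ → UH3} {s : ℝ × ℝ} (h : ContDiffAt ℝ ∞ (fun r => (φ r : L4 × L4)) s)
    (hs : piHat (φ s) ∈ e.source) (a b : ℝ × ℝ) :
    (∀ om : TwoForm, om (piHat (φ s))
      ![mfderiv 𝓘(ℝ, ℝ × ℝ) 𝓘(ℝ, ℂ × ℂ) (fun r => piHat (φ r)) s a,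
        mfderiv 𝓘(ℝ, ℝ × ℝ) 𝓘(ℝ, ℂ × ℂ) (fun r => piHat (φ r)) s b] =
      chartExpr om e (e (piHat (φ s)))
        ![fderiv ℝ (fun r => e (piHat (φ r))) s a, fderiv ℝ (fun r => e (piHat (φ r))) s b]) ∧
    coordOmega (e (piHat (φ s)))
      ![fderiv ℝ (fun r => e (piHat (φ r))) s a, fderiv ℝ (fun r => e (piHat (φ r))) s b] =
      dTheta (φ s) ![pushUH3 h a, pushUH3 h b] := by
  obtain ⟨ε, hε, h1, h2, ht⟩ := exists_sign he
  have hs' := (h1 _).1 hs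
  have hev : ∀ᶠ r in 𝓝 s, (φ r : L4 × L4) ∈ endDom ε :=
    h.continuousAt.eventually ((isOpen_endDom ε).mem_nhds hs')
  have hfg : (fun r => piHat (φ r)) =ᶠ[𝓝 s] fun r => e.symm (e (piHat (φ r))) := by
    filter_upwards [hev] with r hr
    exact (e.left_inv ((h1 _).2 hr)).symm
  have hge : (fun r => e (piHat (φ r))) =ᶠ[𝓝 s] fun r => endCoord ε (φ r) := by
    filter_upwards [hev] with r hr
    exact h2 _ hr
  have hgd : DifferentiableAt ℝ (fun r => e (piHat (φ r))) s :=
    (ContDiffAt.comp (g := endCoord ε) s (contDiffAt_endCoord hs') h).differentiableAt (by simp)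
      |>.congr_of_eventuallyEq hge
  refine ⟨fun om => apply_mfderiv he hfg hgd (e.map_source hs) a b, ?_⟩
  rw [hge.fderiv_eq, h2 _ hs']
  exact (coordOmega_endCoord hε h hs' a b).2

lemma pullbackEqDTheta_canonicalForm : PullbackEqDTheta canonicalForm := by
  intro φ s h a b
  have he := chart_mem_atlas (ℂ × ℂ) (piHat (φ s))
  have hs := mem_chart_source (ℂ × ℂ) (piHat (φ s))
  obtain ⟨h1, h2⟩ := pullback_chart he h hs a b
  rw [h1, chartExpr_canonicalForm he ((chartAt (ℂ × ℂ) (piHat (φ s))).map_source hs), h2]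

/-- Every pair of tangent vectors of `LH3` at a point is the image of a pair of tangent vectors of
`UH3`, so that a `2`-form is determined by its pullback. -/
lemma eq_canonicalForm {om : TwoForm} (hom : PullbackEqDTheta om) : om = canonicalForm := by
  funext x
  apply alternating_ext
  intro X Y
  have he := chart_mem_atlas (ℂ × ℂ) x
  have hx := mem_chart_source (ℂ × ℂ) x
  refine (chartExpr_chartAt om x X Y).symm.trans
    (Eq.trans ?_ (chartExpr_chartAt canonicalForm x X Y))
  have hz := (chartAt (ℂ × ℂ) x).map_source hx
  generalize chartAt (ℂ × ℂ) x x = z at *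
  generalize chartAt (ℂ × ℂ) x = e at *
  obtain ⟨ε, hε, h1, h2, ht⟩ := exists_sign he
  have hz' := one_add_ne_zero he hz
  have h0 : e (piHat (sectPlane ε z X Y 0)) = z ∧ piHat (sectPlane ε z X Y 0) ∈ e.source := by
    rw [sectPlane_eq hε (by simpa using hz')]
    simp only [Prod.fst_zero, Prod.snd_zero, zero_smul, add_zero]
    obtain ⟨k1, k2⟩ := endCoord_sect hε hz'
    exact ⟨(h2 _ k1).trans k2, (h1 _).2 k1⟩
  have hφ := contDiffAt_sectPlane hε hz' X Y
  have h3 := (pullback_chart he hφ h0.2 (1, 0) (0, 1)).1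
  have hev : (fun r => e (piHat (sectPlane ε z X Y r))) =ᶠ[𝓝 0]
      fun r : ℝ × ℝ => z + (r.1 • X + r.2 • Y) := by
    filter_upwards [eventually_plane X Y (eventually_target hz')] with r hr
    obtain ⟨k1, k2⟩ := endCoord_sect hε hr
    rw [sectPlane_eq hε hr, h2 _ k1]
    exact k2
  have hX : planeCLM X Y (1, 0) = X := by simp [planeCLM]
  have hY : planeCLM X Y (0, 1) = Y := by simp [planeCLM]
  rw [hev.fderiv_eq, (hasFDerivAt_plane z X Y).fderiv, hX, hY, h0.1] at h3
  rw [← h3, ← h3, hom _ 0 hφ, pullbackEqDTheta_canonicalForm _ 0 hφ]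

/-! ### The Kähler and para-Kähler forms -/

lemma omegaJ_eq_neg_omegaP (x : LH3) (X Y : TLH3 x) : omegaJ x X Y = -omegaP x X Y := by
  have h : G x X (J x Y) = -Complex.I * G x X (P x Y) := by
    simp only [G, J, P, ContinuousLinearEquiv.apply_symm_apply, coordG, map_mul, Complex.conj_I]
    ring
  rw [omegaJ, omegaP, Gi, Gr, h]
  simp

lemma omegaP_eq_canonicalForm (x : LH3) (X Y : TLH3 x) :
    omegaP x X Y = 2 * canonicalForm x ![X, Y] := by
  have h : canonicalForm x ![X, Y] = _ := coordOmega_apply (chartAt_ne_zero x) X Y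
  rw [h, omegaP, Gr, ← Complex.re_ofReal_mul]
  congr 1
  simp only [G, P, coordG, dmu]
  change 4 * ((X.1 * conj Y.2 + -Y.1 * conj X.2) / 2) / _ = _
  push_cast
  ring

end HypGeod
end

theorem mainTheorem3 :
    (∃! om : HypGeod.TwoForm, HypGeod.IsCanonicalSymplecticForm om) ∧
    ∀ om : HypGeod.TwoForm, HypGeod.IsCanonicalSymplecticForm om →
      ∀ (x : HypGeod.LH3) (X Y : HypGeod.TLH3 x),
        HypGeod.omegaJ x X Y = -HypGeod.omegaP x X Y ∧
        -HypGeod.omegaP x X Y = -(2 * om x ![X, Y]) := by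
  refine ⟨⟨HypGeod.canonicalForm, ⟨HypGeod.isSymplectic_canonicalForm,
    HypGeod.pullbackEqDTheta_canonicalForm⟩, fun om h => HypGeod.eq_canonicalForm h.2⟩, ?_⟩
  intro om h x X Y
  rw [HypGeod.eq_canonicalForm h.2]
  exact ⟨HypGeod.omegaJ_eq_neg_omegaP x X Y,
    congrArg Neg.neg (HypGeod.omegaP_eq_canonicalForm x X Y)⟩
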